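/- Let $m(x)$ be the column vector of the $10$ monomials of degree $3$ in $x_1,x_2,x_3$, and for $\sigma\in S_3$ let $D(\sigma)$ be the $10\times 10$ matrix, in this basis, of the substitution $x_i\mapsto x_{\sigma(i)}$ on $\mathbb{R}[x_1,x_2,x_3]_3$. For a symmetric form $f\in\mathbb{R}[x_1,x_2,x_3]_6$ the symmetry adapted Gram spectrahedron of $f$ is $$K_f^{S_3}=\{Q\in\mathbb{R}^{10\times 10}: Q \text{ symmetric positive semidefinite},\ D(\sigma)^TQD(\sigma)=Q \text{ for all }\sigma\in S_3,\ m(x)^TQ\,m(x)=f(x)\}.$$ A symmetric sextic form $f$ is determined by its seven coefficients $a(f)=(a_1,\dots,a_7)\in\mathbb{R}^7$ at $x_1^6,\ x_1^5x_2,\ x_1^4x_2^2,\ x_1^4x_2x_3,\ x_1^3x_2^3,\ x_1^3x_2^2x_3,\ x_1^2x_2^2x_3^2$; it is SOS if it is a finite sum of squares of real cubic forms. Theorem. If a generic symmetric form $f\in\mathbb{R}[x_1,x_2,x_3]_6$ is SOS, then $4$ is the minimal rank of the matrices in $K_f^{S_3}$, and it is attained at extreme points. Precisely: there is a nonzero polynomial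 $P\in\mathbb{R}[a_1,\dots,a_7]$ such that for every symmetric form $f\in\mathbb{R}[x_1,x_2,x_3]_6$ with $P(a(f))\neq 0$ that is SOS, every matrix in $K_f^{S_3}$ has rank at least $4$, and $K_f^{S_3}$ has an extreme point of rank $4$. -/

import Mathlib

open MvPolynomial

noncomputable section

/-- A form of degree `2d` in `n` variables is SOS if it is a sum of squares of forms of degree `d`. -/
def IsSOSForm (n d : ℕ) (f : MvPolynomial (Fin n) ℝ) : Prop :=
  ∃ (k : ℕ) (q : Fin k → MvPolynomial (Fin n) ℝ),
    (∀ i, (q i).IsHomogeneous d) ∧ f = ∑ i, q i ^ 2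

/-- The monomial of degree `d` attached to a multiset of `d` variables. These monomials are the
basis `m(x)` of the space of forms of degree `d`; it has `(n + d - 1).choose d` elements. -/
def monoForm {n d : ℕ} (s : Sym (Fin n) d) : MvPolynomial (Fin n) ℝ :=
  ((s : Multiset (Fin n)).map X).prod

/-- The matrix `D(σ)`, in the basis of monomials of degree `d`, of the linear substitution
`x_i ↦ x_{σ(i)}` on forms of degree `d` (see `rename_monoForm`). -/
def permRep {n d : ℕ} (σ : Equiv.Perm (Fin n)) : Matrix (Sym (Fin n) d) (Sym (Fin n) d) ℝ :=
  Matrix.of fun s t => if s = t.map σ then 1 else 0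

theorem rename_monoForm {n d : ℕ} (σ : Equiv.Perm (Fin n)) (t : Sym (Fin n) d) :
    rename σ (monoForm t) = ∑ s, permRep σ s t • monoForm s := by
  simp [permRep, monoForm, ite_smul, map_multiset_prod, Multiset.map_map]

/-- The polynomial `m(x)ᵀ Q m(x)`. -/
def gramForm {n d : ℕ} (Q : Matrix (Sym (Fin n) d) (Sym (Fin n) d) ℝ) :
    MvPolynomial (Fin n) ℝ :=
  ∑ s, ∑ t, C (Q s t) * (monoForm s * monoForm t)

/-- The symmetry adapted PSD cone of the symmetric group acting on forms of degree `d`. -/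
def symPSDCone (n d : ℕ) : Set (Matrix (Sym (Fin n) d) (Sym (Fin n) d) ℝ) :=
  {Q | Q.PosSemidef ∧ ∀ σ : Equiv.Perm (Fin n), (permRep σ).transpose * Q * permRep σ = Q}

/-- The symmetry adapted Gram spectrahedron of a symmetric form `f` of degree `2d`. -/
def symGramSpectrahedron (n d : ℕ) (f : MvPolynomial (Fin n) ℝ) :
    Set (Matrix (Sym (Fin n) d) (Sym (Fin n) d) ℝ) :=
  {Q | Q ∈ symPSDCone n d ∧ gramForm Q = f}

/-- The monomial `x₁^i x₂^j x₃^k` as an exponent vector. -/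
def ternaryExp (i j k : ℕ) : Fin 3 →₀ ℕ := Finsupp.equivFunOnFinite.symm ![i, j, k]

/-- The seven coefficients that parametrize a symmetric ternary sextic: those at
`x₁⁶, x₁⁵x₂, x₁⁴x₂², x₁⁴x₂x₃, x₁³x₂³, x₁³x₂²x₃, x₁²x₂²x₃²`. -/
def sexticCoeffs (f : MvPolynomial (Fin 3) ℝ) : Fin 7 → ℝ :=
  ![f.coeff (ternaryExp 6 0 0), f.coeff (ternaryExp 5 1 0), f.coeff (ternaryExp 4 2 0),
    f.coeff (ternaryExp 4 1 1), f.coeff (ternaryExp 3 3 0), f.coeff (ternaryExp 3 2 1),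
    f.coeff (ternaryExp 2 2 2)]

end

open scoped Matrix

/-!
By Schur's lemma an invariant Gram matrix of a ternary sextic is block diagonal: ternary cubics
contain the trivial representation of `S₃` three times, the standard one three times and the sign
once, so the matrix is given by two positive semidefinite `3 × 3` blocks `A`, `B` and a number
`c ≥ 0`, and its rank is `rank A + 2 rank B + rank c`. The form determines `A` and `c` from `B`.

Rank at most `3` forces `B = 0` with `c = 0` or `det A = 0`, or `rank B = 1` with `A = 0` or with
`rank A ≤ 1` and `c = 0`. In the last case the form depends polynomially on six parameters instead
of seven; the other cases are visibly confined to hypersurfaces.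

To reach rank `4`, restrict to the cuspidal curve where `c` does not contribute. The form becomes a
nonnegative univariate sextic without linear term, which is a sum of two squares of polynomials, one
without linear and one without constant term; these give `A` and `B` of rank at most one. If the
number `c` they require is nonnegative we are done. Otherwise move from a given solution towards
this one, keeping only the first rank one part `w wᵀ` of `B`, until `c = 0` (if `w` vanishes, then
`B = 0` and the rank is at most `3 + 1`). As `c` involves just one coordinate of `w`, another one
can be changed until `A` becomes singular, and the rank is at most `2 + 2`. Finally, the face of
the matrices whose kernel contains that of this solution is compact, so it has an extreme point.
-/

theorem exists_eq_sq_add_sq_mul_of_forall_eval_nonneg {p : Polynomial ℝ}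
    (hp : ∀ x, 0 ≤ p.eval x) (hdeg : p.natDegree ≠ 0) :
    ∃ (u v : ℝ) (p' : Polynomial ℝ),
      p = ((Polynomial.X - Polynomial.C u) ^ 2 + Polynomial.C v ^ 2) * p' ∧ ∀ x, 0 ≤ p'.eval x := by
  obtain ⟨z, hz⟩ := IsAlgClosed.exists_aeval_eq_zero ℂ p
    (mt Polynomial.natDegree_eq_of_degree_eq_some hdeg)
  suffices h : ∃ p' : Polynomial ℝ,
      p = ((Polynomial.X - Polynomial.C z.re) ^ 2 + Polynomial.C z.im ^ 2) * p' by
    obtain ⟨p', hpp'⟩ := h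
    refine ⟨z.re, z.im, p', hpp', fun x => ?_⟩
    have hsub : closure ({z.re}ᶜ : Set ℝ) ⊆ {y | 0 ≤ p'.eval y} := by
      refine closure_minimal (fun y hy => ?_) (isClosed_le continuous_const p'.continuous)
      have hy' : 0 < (y - z.re) ^ 2 + z.im ^ 2 := by
        have := sub_ne_zero.mpr hy
        positivity
      have hpy := hp y
      rw [hpp'] at hpy
      simp only [Polynomial.eval_mul, Polynomial.eval_add, Polynomial.eval_pow,
        Polynomial.eval_sub, Polynomial.eval_X, Polynomial.eval_C] at hpy
      exact nonneg_of_mul_nonneg_right hpy hy'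
    exact hsub ((dense_compl_singleton z.re).closure_eq ▸ Set.mem_univ x)
  by_cases him : z.im = 0
  · have hroot : p.IsRoot z.re := by
      rw [show z = algebraMap ℝ ℂ z.re from Complex.ext rfl him,
        Polynomial.aeval_algebraMap_apply] at hz
      simpa using hz
    have hder : p.derivative.IsRoot z.re := by
      rw [Polynomial.IsRoot, ← Polynomial.deriv]
      exact IsLocalMin.deriv_eq_zero (.of_forall fun y => hroot.eq_zero.trans_le (hp y))
    have hp0 : p ≠ 0 := by
      rintro rfl
      exact hdeg Polynomial.natDegree_zero
    obtain ⟨p', hp'⟩ : (Polynomial.X - Polynomial.C z.re) ^ 2 ∣ p :=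
      (Polynomial.le_rootMultiplicity_iff hp0).mp
        ((Polynomial.one_lt_rootMultiplicity_iff_isRoot hp0).mpr ⟨hroot, hder⟩)
    exact ⟨p', by rw [him, map_zero, zero_pow two_ne_zero, add_zero, ← hp']⟩
  · obtain ⟨p', hp'⟩ := p.quadratic_dvd_of_aeval_eq_zero_im_ne_zero hz him
    refine ⟨p', hp'.trans ?_⟩
    rw [← Complex.normSq_eq_norm_sq, Complex.normSq_apply]
    simp only [map_mul, map_add, map_ofNat]
    ring

theorem exists_eq_sq_add_sq_of_forall_eval_nonneg (p : Polynomial ℝ) (hp : ∀ x, 0 ≤ p.eval x) :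
    ∃ q r : Polynomial ℝ, p = q ^ 2 + r ^ 2 := by
  induction hn : p.natDegree using Nat.strong_induction_on generalizing p with
  | _ n ih =>
  subst hn
  by_cases hdeg : p.natDegree = 0
  · obtain ⟨a, rfl⟩ := Polynomial.natDegree_eq_zero.mp hdeg
    refine ⟨.C √a, 0, ?_⟩
    rw [← Polynomial.C_pow, Real.sq_sqrt (by simpa using hp 0), zero_pow two_ne_zero, add_zero]
  obtain ⟨u, v, p', rfl, hp'⟩ := exists_eq_sq_add_sq_mul_of_forall_eval_nonneg hp hdeg
  have hquad : ((Polynomial.X - Polynomial.C u) ^ 2 + Polynomial.C v ^ 2).natDegree = 2 := by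
    compute_degree!
  have hlt : p'.natDegree <
      (((Polynomial.X - Polynomial.C u) ^ 2 + Polynomial.C v ^ 2) * p').natDegree := by
    rw [Polynomial.natDegree_mul (by intro h; simp [h] at hquad) (by rintro rfl; simp at hdeg),
      hquad]
    omega
  obtain ⟨q, r, rfl⟩ := ih _ hlt p' hp' rfl
  exact ⟨(Polynomial.X - Polynomial.C u) * q - Polynomial.C v * r,
    (Polynomial.X - Polynomial.C u) * r + Polynomial.C v * q, by ring⟩

theorem degree_sq_add_sq {R : Type*} [CommRing R] [LinearOrder R] [IsStrictOrderedRing R]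
    (q r : Polynomial R) : (q ^ 2 + r ^ 2).degree = max (q ^ 2).degree (r ^ 2).degree := by
  rcases eq_or_ne q 0 with rfl | hq
  · simp [zero_pow two_ne_zero]
  refine Polynomial.degree_add_eq_of_leadingCoeff_add_ne_zero ?_
  rw [Polynomial.leadingCoeff_pow, Polynomial.leadingCoeff_pow]
  have := Polynomial.leadingCoeff_ne_zero.mpr hq
  positivity

theorem natDegree_le_of_natDegree_sq_add_sq_le {R : Type*} [CommRing R] [LinearOrder R]
    [IsStrictOrderedRing R] {q r : Polynomial R} {n : ℕ}
    (h : (q ^ 2 + r ^ 2).natDegree ≤ 2 * n) : q.natDegree ≤ n ∧ r.natDegree ≤ n := by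
  rw [Polynomial.natDegree_le_iff_degree_le, degree_sq_add_sq, max_le_iff,
    ← Polynomial.natDegree_le_iff_degree_le, ← Polynomial.natDegree_le_iff_degree_le,
    Polynomial.natDegree_pow, Polynomial.natDegree_pow] at h
  omega

theorem exists_rotation_mul_eq_mul (x y : ℝ) : ∃ c s : ℝ, c ^ 2 + s ^ 2 = 1 ∧ c * y = s * x := by
  refine ⟨Real.cos (⟨x, y⟩ : ℂ).arg, Real.sin (⟨x, y⟩ : ℂ).arg, Real.cos_sq_add_sin_sq _, ?_⟩
  have hx := Complex.norm_mul_cos_arg ⟨x, y⟩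
  have hy := Complex.norm_mul_sin_arg ⟨x, y⟩
  linear_combination Real.sin _ * hx - Real.cos _ * hy

theorem exists_rotation_of_mul_add_mul_eq_zero {x y x' y' : ℝ} (h : x * x' + y * y' = 0) :
    ∃ c s : ℝ, c ^ 2 + s ^ 2 = 1 ∧ c * y = s * x ∧ c * x' = -(s * y') := by
  by_cases hxy : x = 0 ∧ y = 0
  · obtain ⟨c, s, hcs, hrot⟩ := exists_rotation_mul_eq_mul (-y') x'
    exact ⟨c, s, hcs, by simp [hxy], by linarith⟩
  · obtain ⟨c, s, hcs, hrot⟩ := exists_rotation_mul_eq_mul x y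
    refine ⟨c, s, hcs, hrot, ?_⟩
    have hx : x * (c * x' + s * y') = 0 := by linear_combination c * h - y' * hrot
    have hy : y * (c * x' + s * y') = 0 := by linear_combination s * h + x' * hrot
    by_contra hne
    have hne' : c * x' + s * y' ≠ 0 := fun h0 => hne (by linarith)
    exact hxy ⟨(mul_eq_zero.mp hx).resolve_right hne', (mul_eq_zero.mp hy).resolve_right hne'⟩

theorem exists_eq_sq_add_sq_of_coeff_one_eq_zero {p : Polynomial ℝ} (hp : ∀ x, 0 ≤ p.eval x)
    (h1 : p.coeff 1 = 0) :
    ∃ q r : Polynomial ℝ, p = q ^ 2 + r ^ 2 ∧ q.coeff 1 = 0 ∧ r.coeff 0 = 0 := by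
  obtain ⟨q, r, rfl⟩ := exists_eq_sq_add_sq_of_forall_eval_nonneg p hp
  have horth : q.coeff 0 * q.coeff 1 + r.coeff 0 * r.coeff 1 = 0 := by
    rw [Polynomial.coeff_add, sq, sq, Polynomial.mul_coeff_one, Polynomial.mul_coeff_one] at h1
    linarith
  obtain ⟨c, s, hcs, h0, h1⟩ := exists_rotation_of_mul_add_mul_eq_zero horth
  refine ⟨.C c * q + .C s * r, .C c * r - .C s * q, ?_, ?_, ?_⟩
  · have hcs' : (.C c ^ 2 + .C s ^ 2 : Polynomial ℝ) = 1 := by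
      rw [← map_pow, ← map_pow, ← map_add, hcs, map_one]
    linear_combination -(q ^ 2 + r ^ 2) * hcs'
  · simp [h1]
  · simp [h0]

section PosSemidef

variable {n : Type*} {A : Matrix n n ℝ}

theorem isSymm_of_posSemidef (hA : A.PosSemidef) : A.IsSymm := by
  rw [Matrix.IsSymm, ← Matrix.conjTranspose_eq_transpose_of_trivial]
  exact hA.isHermitian

theorem posSemidef_vecMulVec_self [Finite n] (v : n → ℝ) : (Matrix.vecMulVec v v).PosSemidef := by
  simpa using Matrix.posSemidef_vecMulVec_self_star v

theorem dotProduct_mulVec_comm_of_isSymm [Fintype n] (hA : A.IsSymm) (u v : n → ℝ) :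
    u ⬝ᵥ A *ᵥ v = v ⬝ᵥ A *ᵥ u := by
  rw [Matrix.dotProduct_mulVec, ← Matrix.mulVec_transpose, hA.eq, dotProduct_comm]

theorem sq_dotProduct_mulVec_le_of_posSemidef [Fintype n] (hA : A.PosSemidef) (u v : n → ℝ) :
    (u ⬝ᵥ A *ᵥ v) ^ 2 ≤ (u ⬝ᵥ A *ᵥ u) * (v ⬝ᵥ A *ᵥ v) := by
  classical
  have hsymm : LinearMap.IsSymm (Matrix.toBilin' A) := ⟨fun x y => by
    simpa only [Matrix.toBilin'_apply', RingHom.id_apply] using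
      dotProduct_mulVec_comm_of_isSymm (isSymm_of_posSemidef hA) x y⟩
  simpa only [Matrix.toBilin'_apply'] using (Matrix.toBilin' A).apply_sq_le_of_symm
    (fun x => by simpa only [Matrix.toBilin'_apply', star_trivial]
      using hA.dotProduct_mulVec_nonneg x) hsymm u v

theorem sq_apply_le_of_posSemidef [Finite n] (hA : A.PosSemidef) (i j : n) :
    A i j ^ 2 ≤ A i i * A j j := by
  classical
  have := Fintype.ofFinite n
  simpa using sq_dotProduct_mulVec_le_of_posSemidef hA (Pi.single i 1) (Pi.single j 1)

theorem row_eq_zero_of_posSemidef [Finite n] (hA : A.PosSemidef) {i : n} (hi : A i i = 0) :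
    A i = 0 := by
  ext j
  have h := sq_apply_le_of_posSemidef hA i j
  rw [hi, zero_mul] at h
  exact pow_eq_zero_iff two_ne_zero |>.mp (h.antisymm (sq_nonneg _))

theorem eq_zero_of_posSemidef_of_diag_eq_zero [Finite n] (hA : A.PosSemidef)
    (h : ∀ i, A i i = 0) : A = 0 :=
  funext fun i => row_eq_zero_of_posSemidef hA (h i)

/-- The vector whose square is the rank one part split off by one Cholesky step with pivot `i`. When
the pivot entry is zero it is zero, by the convention `0⁻¹ = 0`. -/
noncomputable def pivotVec (A : Matrix n n ℝ) (i : n) : n → ℝ := (√(A i i))⁻¹ • A i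

theorem vecMulVec_pivotVec (hA : A.PosSemidef) (i : n) :
    Matrix.vecMulVec (pivotVec A i) (pivotVec A i) = (A i i)⁻¹ • Matrix.vecMulVec (A i) (A i) := by
  rw [pivotVec, Matrix.smul_vecMulVec, Matrix.vecMulVec_smul, smul_smul, ← mul_inv,
    Real.mul_self_sqrt hA.diag_nonneg]

theorem vecMulVec_pivotVec_apply [Finite n] (hA : A.PosSemidef) (i j : n) :
    Matrix.vecMulVec (pivotVec A i) (pivotVec A i) i j = A i j := by
  rw [vecMulVec_pivotVec hA, Matrix.smul_apply, Matrix.vecMulVec_apply, smul_eq_mul]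
  rcases eq_or_ne (A i i) 0 with hi | hi
  · simp [row_eq_zero_of_posSemidef hA hi]
  · field_simp

theorem posSemidef_sub_vecMulVec_pivotVec [Finite n] (hA : A.PosSemidef) (i : n) :
    (A - Matrix.vecMulVec (pivotVec A i) (pivotVec A i)).PosSemidef := by
  classical
  have := Fintype.ofFinite n
  refine .of_dotProduct_mulVec_nonneg
    (hA.isHermitian.sub (posSemidef_vecMulVec_self _).isHermitian) fun v => ?_
  have hcs := sq_dotProduct_mulVec_le_of_posSemidef hA (Pi.single i 1) v
  rw [Matrix.mulVec_single_one, single_one_dotProduct, single_one_dotProduct, Matrix.col_apply,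
    Matrix.mulVec, mul_comm] at hcs
  rw [vecMulVec_pivotVec hA, star_trivial, Matrix.sub_mulVec, Matrix.smul_mulVec,
    Matrix.vecMulVec_mulVec, dotProduct_sub, dotProduct_smul, dotProduct_smul,
    dotProduct_comm _ (A i),
    op_smul_eq_smul, smul_eq_mul, smul_eq_mul, ← sq, sub_nonneg, inv_mul_eq_div]
  exact div_le_of_le_mul₀ hA.diag_nonneg (by simpa using hA.dotProduct_mulVec_nonneg v) hcs

theorem exists_eq_vecMulVec_of_posSemidef_of_rank_le_one [Fintype n] (hA : A.PosSemidef)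
    (h : A.rank ≤ 1) : ∃ v, A = Matrix.vecMulVec v v := by
  by_cases h0 : ∀ i, A i i = 0
  · exact ⟨0, by simp [eq_zero_of_posSemidef_of_diag_eq_zero hA h0]⟩
  obtain ⟨i, hi⟩ := not_forall.mp h0
  refine ⟨pivotVec A i, sub_eq_zero.mp <| eq_zero_of_posSemidef_of_diag_eq_zero
    (posSemidef_sub_vecMulVec_pivotVec hA i) fun j => ?_⟩
  have hminor : (A.submatrix ![i, j] ![i, j]).det = 0 := by
    by_contra hne
    have hrank := (A.rank_submatrix_le ![i, j] ![i, j]).trans h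
    rw [Matrix.rank_of_det_ne_zero hne, Fintype.card_fin] at hrank
    exact absurd hrank (by norm_num)
  rw [vecMulVec_pivotVec hA, Matrix.sub_apply, Matrix.smul_apply, Matrix.vecMulVec_apply,
    smul_eq_mul, sub_eq_zero, eq_inv_mul_iff_mul_eq₀ hi, ← sub_eq_zero]
  rw [Matrix.det_fin_two] at hminor
  simpa [(isSymm_of_posSemidef hA).apply i j] using hminor

theorem isClosed_setOf_posSemidef [Finite n] : IsClosed {A : Matrix n n ℝ | A.PosSemidef} := by
  have := Fintype.ofFinite n
  simp only [Matrix.posSemidef_iff_dotProduct_mulVec, Set.ofPred_and, Set.ofPred_forall]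
  refine .inter (isClosed_eq (by fun_prop) (by fun_prop)) (isClosed_iInter fun v => ?_)
  exact isClosed_le continuous_const (by fun_prop)

theorem posSemidef_of_forall_mem_sphere [Fintype n] (hA : A.IsHermitian)
    (h : ∀ v ∈ Metric.sphere (0 : n → ℝ) 1, 0 ≤ v ⬝ᵥ A *ᵥ v) : A.PosSemidef := by
  refine .of_dotProduct_mulVec_nonneg hA fun v => ?_
  rcases eq_or_ne v 0 with rfl | hv
  · simp
  have hn := norm_ne_zero_iff.mpr hv
  have hunit := h (‖v‖⁻¹ • v) (by simp [norm_smul, hn])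
  rw [Matrix.mulVec_smul, dotProduct_smul, smul_dotProduct, smul_smul, smul_eq_mul] at hunit
  simpa using nonneg_of_mul_nonneg_right hunit (by positivity)

theorem exists_posSemidef_det_eq_zero [Fintype n] [DecidableEq n] {X : Type*} [TopologicalSpace X]
    [PreconnectedSpace X] {M : X → Matrix n n ℝ} (hM : Continuous M)
    (hherm : ∀ x, (M x).IsHermitian) {x₀ x₁ : X} (h₀ : (M x₀).PosSemidef)
    (h₁ : ¬ (M x₁).PosSemidef) : ∃ x, (M x).PosSemidef ∧ (M x).det = 0 := by
  have hclosed : IsClosed {x | (M x).PosSemidef} := isClosed_setOf_posSemidef.preimage hM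
  obtain ⟨x, hx⟩ := (nonempty_frontier_iff (s := {x | (M x).PosSemidef})).mpr
    ⟨⟨x₀, h₀⟩, (Set.ne_univ_iff_exists_notMem _).mpr ⟨x₁, h₁⟩⟩
  rw [hclosed.frontier_eq] at hx
  refine ⟨x, hx.1, by_contra fun hdet => hx.2 ?_⟩
  have hpos := (hx.1.posDef_iff_det_ne_zero.mpr hdet)
  have hnear : ∀ᶠ y in nhds x, ∀ v ∈ Metric.sphere (0 : n → ℝ) 1, 0 < v ⬝ᵥ M y *ᵥ v := by
    refine (isCompact_sphere 0 1).eventually_forall_of_forall_eventually fun v hv => ?_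
    have hcont : Continuous fun z : X × (n → ℝ) => z.2 ⬝ᵥ M z.1 *ᵥ z.2 :=
      continuous_snd.dotProduct ((hM.comp continuous_fst).matrix_mulVec continuous_snd)
    refine hcont.continuousAt.eventually_const_lt ?_
    simpa using hpos.dotProduct_mulVec_pos (ne_zero_of_mem_unit_sphere ⟨v, hv⟩)
  exact mem_interior_iff_mem_nhds.mpr <| hnear.mono fun y hy =>
    posSemidef_of_forall_mem_sphere (hherm y) fun v hv => (hy v hv).le

end PosSemidef

section Rank

variable {K m n o p : Type*} [Field K] [Fintype n] [Fintype p]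

theorem rank_matrix_add_le [Finite m] (A B : Matrix m n K) :
    (A + B).rank ≤ A.rank + B.rank := by
  have := Fintype.ofFinite m
  rw [Matrix.rank, Matrix.mulVecLin_add]
  exact (Submodule.finrank_mono (LinearMap.range_add_le _ _)).trans
    (Submodule.finrank_add_le_finrank_add_finrank _ _)

theorem rank_add_rank_le_rank_fromBlocks [Finite m] [Finite o] (A : Matrix m n K)
    (D : Matrix o p K) : A.rank + D.rank ≤ (Matrix.fromBlocks A 0 0 D).rank := by
  have := Fintype.ofFinite m
  have := Fintype.ofFinite o
  let e := LinearEquiv.sumArrowLequivProdArrow m o K K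
  have hrange : LinearMap.range (A.mulVecLin.prodMap D.mulVecLin) ≤
      (LinearMap.range (Matrix.fromBlocks A 0 0 D).mulVecLin).map e.toLinearMap := by
    rintro _ ⟨⟨u, v⟩, rfl⟩
    refine ⟨_, ⟨Sum.elim u v, rfl⟩, ?_⟩
    refine Prod.ext (funext fun i => ?_) (funext fun i => ?_) <;>
      simp [e, Matrix.fromBlocks_mulVec]
  have hle := Submodule.finrank_mono hrange
  rw [LinearEquiv.finrank_map_eq, LinearMap.range_prodMap] at hle
  refine le_trans (le_of_eq ?_) hle
  have hinj : Function.Injective ((LinearMap.range A.mulVecLin).subtype.prodMap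
      (LinearMap.range D.mulVecLin).subtype) :=
    Subtype.val_injective.prodMap Subtype.val_injective
  rw [Matrix.rank, Matrix.rank, ← Module.finrank_prod, ← LinearMap.finrank_range_of_inj hinj,
    LinearMap.range_prodMap, Submodule.range_subtype, Submodule.range_subtype]

theorem rank_sum_conj_le [Fintype m] {Z : Fin 3 → Matrix m n K} (hZ : ∑ k, Z k = 0)
    (B : Matrix n n K) : (∑ k, Z k * B * (Z k)ᵀ).rank ≤ 2 * B.rank := by
  rw [Fin.sum_univ_three, add_eq_zero_iff_eq_neg'] at hZ
  have hsum : ∑ k, Z k * B * (Z k)ᵀ =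
      Z 0 * B * ((2 : K) • Z 0 + Z 1)ᵀ + Z 1 * B * (Z 0 + (2 : K) • Z 1)ᵀ := by
    simp only [Fin.sum_univ_three, hZ, two_smul, Matrix.transpose_add, Matrix.transpose_neg,
      Matrix.mul_add, Matrix.add_mul, Matrix.mul_neg, Matrix.neg_mul]
    abel
  have hle (Y X : Matrix m n K) : (Y * B * Xᵀ).rank ≤ B.rank :=
    (Matrix.rank_mul_le_left _ _).trans (Matrix.rank_mul_le_right _ _)
  rw [hsum, two_mul]
  exact (rank_matrix_add_le _ _).trans (add_le_add (hle _ _) (hle _ _))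

theorem eq_zero_of_rank_matrix_eq_zero [Finite m] {A : Matrix m n K} (h : A.rank = 0) :
    A = 0 := by
  classical
  have := Fintype.ofFinite m
  rw [Matrix.rank, Submodule.finrank_eq_zero, LinearMap.range_eq_bot] at h
  exact Matrix.toLin'.map_eq_zero_iff.mp h

theorem det_eq_zero_iff_rank_lt [DecidableEq n] {A : Matrix n n K} :
    A.det = 0 ↔ A.rank < Fintype.card n := by
  refine ⟨fun h => ?_, not_imp_not.mp fun h => ?_⟩
  · obtain ⟨v, hv, hAv⟩ := Matrix.exists_mulVec_eq_zero_iff.mpr h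
    have hpos : 0 < Module.finrank K (LinearMap.ker A.mulVecLin) :=
      Module.finrank_pos_iff_exists_ne_zero.mpr ⟨⟨v, hAv⟩, fun h => hv (congrArg Subtype.val h)⟩
    have hsum := A.mulVecLin.finrank_range_add_finrank_ker
    rw [Module.finrank_fintype_fun_eq_card] at hsum
    rw [Matrix.rank]
    omega
  · rw [Matrix.rank_of_det_ne_zero h]
    exact lt_irrefl _

end Rank

noncomputable section

/-- The linear invariant of `S₃`, called `e` below. -/
def sumVar : MvPolynomial (Fin 3) ℝ := X 0 + X 1 + X 2

/-- The linear forms `y_k = 3 x_k - e`, which span the standard representation of `S₃`. They are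
permuted like the variables and sum to zero. -/
def devVar (k : Fin 3) : MvPolynomial (Fin 3) ℝ := 3 * X k - sumVar

/-- The quadratic invariant `q` in the `y_k`, normalized so that
`t³ - 3 q t - 2 r = (t - y₀) (t - y₁) (t - y₂)`, with `r` the cubic invariant `devCub`. -/
def devQuad : MvPolynomial (Fin 3) ℝ := C (1 / 6) * ∑ k, devVar k ^ 2

/-- The cubic invariant `r` in the `y_k`. -/
def devCub : MvPolynomial (Fin 3) ℝ := C (1 / 2) * ∏ k, devVar k

/-- The cubic form spanning the sign representation. Its square is `108 (q³ - r²)`. -/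
def devAlt : MvPolynomial (Fin 3) ℝ := (Matrix.vandermonde devVar).det

/-- The basis `e³, e q, r` of the invariant cubic forms. -/
def invForm : Fin 3 → MvPolynomial (Fin 3) ℝ := ![sumVar ^ 3, sumVar * devQuad, devCub]

/-- The three copies `i = 0, 1, 2` of the standard representation in the cubic forms, each spanned
by three forms which are permuted by `S₃` and sum to zero. -/
def stdForm (i k : Fin 3) : MvPolynomial (Fin 3) ℝ :=
  ![sumVar ^ 2 * devVar k, sumVar * (devVar k ^ 2 - C 2 * devQuad), devQuad * devVar k] i

/-- The basis `e⁶, e⁴ q, e³ r, e² q², e q r, q³, r²` of the symmetric ternary sextics. -/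
def sexticBasis : Fin 7 → MvPolynomial (Fin 3) ℝ :=
  ![sumVar ^ 6, sumVar ^ 4 * devQuad, sumVar ^ 3 * devCub, sumVar ^ 2 * devQuad ^ 2,
    sumVar * devQuad * devCub, devQuad ^ 3, devCub ^ 2]

/-- The symmetric ternary sextic with coordinates `φ` in the basis `sexticBasis`. -/
def symSextic (φ : Fin 7 → ℝ) : MvPolynomial (Fin 3) ℝ := ∑ i, C (φ i) * sexticBasis i

end

theorem sexticCoeffs_symSextic (φ : Fin 7 → ℝ) :
    sexticCoeffs (symSextic φ) = (Matrix.of fun i j => sexticCoeffs (sexticBasis j) i) *ᵥ φ := by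
  ext i
  fin_cases i <;>
    simp [sexticCoeffs, symSextic, coeff_sum, Matrix.mulVec, dotProduct] <;>
    simp only [mul_comm]

theorem devVar_two : devVar 2 = -(devVar 0 + devVar 1) := by
  simp only [devVar, sumVar]
  ring

theorem devAlt_eq : devAlt =
    (devVar 1 - devVar 0) * (devVar 2 - devVar 0) * (devVar 2 - devVar 1) := by
  simp only [devAlt, Matrix.det_fin_three, Matrix.vandermonde_apply, Fin.val_zero, Fin.val_one,
    Fin.val_two]
  ring

theorem sum_stdForm (i : Fin 3) : ∑ k, stdForm i k = 0 := by
  have h6 : 6 * C 6⁻¹ = (1 : MvPolynomial (Fin 3) ℝ) := by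
    rw [← map_ofNat C, ← C_mul]
    norm_num
  have hC : C 2 = (2 : MvPolynomial (Fin 3) ℝ) := map_ofNat C 2
  fin_cases i <;> simp only [stdForm, Fin.sum_univ_three, devQuad, devVar_two, hC] <;> simp
  · ring
  · linear_combination (-2 * sumVar * (devVar 0 ^ 2 + devVar 0 * devVar 1 + devVar 1 ^ 2)) * h6
  · ring

section Homogeneous

theorem isHomogeneous_sumVar : sumVar.IsHomogeneous 1 :=
  ((isHomogeneous_X _ _).add (isHomogeneous_X _ _)).add (isHomogeneous_X _ _)

theorem isHomogeneous_devVar (k : Fin 3) : (devVar k).IsHomogeneous 1 := by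
  rw [devVar, ← map_ofNat C 3]
  exact ((isHomogeneous_X _ _).C_mul 3).sub isHomogeneous_sumVar

theorem isHomogeneous_devQuad : devQuad.IsHomogeneous 2 :=
  .C_mul (.sum _ _ _ fun k _ => (isHomogeneous_devVar k).pow 2) _

theorem isHomogeneous_devCub : devCub.IsHomogeneous 3 :=
  .C_mul (.prod _ _ (fun _ => 1) fun k _ => isHomogeneous_devVar k) _

theorem isHomogeneous_devAlt : devAlt.IsHomogeneous 3 := by
  rw [devAlt_eq]
  exact (((isHomogeneous_devVar 1).sub (isHomogeneous_devVar 0)).mul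
    ((isHomogeneous_devVar 2).sub (isHomogeneous_devVar 0))).mul
    ((isHomogeneous_devVar 2).sub (isHomogeneous_devVar 1))

theorem isHomogeneous_invForm (i : Fin 3) : (invForm i).IsHomogeneous 3 := by
  fin_cases i
  · exact isHomogeneous_sumVar.pow 3
  · exact isHomogeneous_sumVar.mul isHomogeneous_devQuad
  · exact isHomogeneous_devCub

theorem isHomogeneous_stdForm (i k : Fin 3) : (stdForm i k).IsHomogeneous 3 := by
  fin_cases i
  · exact (isHomogeneous_sumVar.pow 2).mul (isHomogeneous_devVar k)
  · exact isHomogeneous_sumVar.mul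
      (((isHomogeneous_devVar k).pow 2).sub (isHomogeneous_devQuad.C_mul 2))
  · exact isHomogeneous_devQuad.mul (isHomogeneous_devVar k)

end Homogeneous

section Action

variable (σ : Equiv.Perm (Fin 3))

theorem rename_sumVar : rename σ sumVar = sumVar := by
  simpa [sumVar, Fin.sum_univ_three] using Equiv.sum_comp σ (X : Fin 3 → MvPolynomial (Fin 3) ℝ)

theorem rename_devVar (k : Fin 3) : rename σ (devVar k) = devVar (σ k) := by
  simp [devVar, rename_sumVar, map_ofNat]

theorem rename_devQuad : rename σ devQuad = devQuad := by
  simp [devQuad, rename_devVar, Equiv.sum_comp σ fun k => devVar k ^ 2]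

theorem rename_devCub : rename σ devCub = devCub := by
  simp [devCub, rename_devVar, Equiv.prod_comp σ devVar]

theorem rename_devAlt : rename σ devAlt = (Equiv.Perm.sign σ : ℤ) * devAlt := by
  rw [devAlt, AlgHom.map_det, ← Matrix.det_permute]
  congr 1
  ext1 i j
  simp [Matrix.vandermonde_apply, rename_devVar]

theorem rename_invForm (i : Fin 3) : rename σ (invForm i) = invForm i := by
  fin_cases i <;> simp [invForm, rename_sumVar, rename_devQuad, rename_devCub]

theorem rename_stdForm (i k : Fin 3) : rename σ (stdForm i k) = stdForm i (σ k) := by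
  fin_cases i <;> simp [stdForm, rename_sumVar, rename_devQuad, rename_devVar]

end Action

/-- The coordinates, in the basis `sexticBasis` of symmetric ternary sextics, of the form with Gram
blocks `A`, `B` and `c` on the isotypic components of cubic forms belonging to the trivial, the
standard and the sign representation of `S₃`. -/
def gramCoord (A B : Matrix (Fin 3) (Fin 3) ℝ) (c : ℝ) : Fin 7 → ℝ :=
  ![A 0 0, 2 * A 0 1 + B 0 0, 2 * A 0 2 + 2 * B 0 1, A 1 1 + 2 * B 0 2 + B 1 1,
    2 * A 1 2 + 2 * B 1 2, B 2 2 + c, A 2 2 - c]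

/-- The rank of the symmetric Gram matrix with blocks `A`, `B` and `c`. The block `B` counts twice
because the standard representation is two-dimensional. -/
noncomputable def blockRank (A B : Matrix (Fin 3) (Fin 3) ℝ) (c : ℝ) : ℕ :=
  A.rank + 2 * B.rank + if c = 0 then 0 else 1

theorem blockRank_le (A B : Matrix (Fin 3) (Fin 3) ℝ) (c : ℝ) :
    blockRank A B c ≤ A.rank + 2 * B.rank + 1 := by
  rw [blockRank]
  split_ifs <;> omega

/-- The trivial block which the coordinates `φ` and the standard block `B` leave no choice for: the
fibre of `gramCoord` over `φ` is parametrized by `B`, the sign block being `φ 5 - B 2 2`. -/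
noncomputable def trivBlock (φ : Fin 7 → ℝ) (B : Matrix (Fin 3) (Fin 3) ℝ) :
    Matrix (Fin 3) (Fin 3) ℝ :=
  !![φ 0, (φ 1 - B 0 0) / 2, (φ 2 - 2 * B 0 1) / 2;
    (φ 1 - B 0 0) / 2, φ 3 - 2 * B 0 2 - B 1 1, (φ 4 - 2 * B 1 2) / 2;
    (φ 2 - 2 * B 0 1) / 2, (φ 4 - 2 * B 1 2) / 2, φ 5 + φ 6 - B 2 2]

theorem gramCoord_trivBlock (φ : Fin 7 → ℝ) (B : Matrix (Fin 3) (Fin 3) ℝ) :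
    gramCoord (trivBlock φ B) B (φ 5 - B 2 2) = φ := by
  ext i
  fin_cases i <;> simp [gramCoord, trivBlock] <;> ring

theorem isSymm_trivBlock (φ : Fin 7 → ℝ) (B : Matrix (Fin 3) (Fin 3) ℝ) :
    (trivBlock φ B).IsSymm := by
  refine .ext fun i j => ?_
  fin_cases i <;> fin_cases j <;> rfl

theorem trivBlock_gramCoord {A : Matrix (Fin 3) (Fin 3) ℝ} (hA : A.IsSymm)
    (B : Matrix (Fin 3) (Fin 3) ℝ) (c : ℝ) : trivBlock (gramCoord A B c) B = A := by
  have h01 := hA.apply 0 1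
  have h02 := hA.apply 0 2
  have h12 := hA.apply 1 2
  ext i j
  fin_cases i <;> fin_cases j <;> simp [gramCoord, trivBlock, h01, h02, h12]
  ring

theorem trivBlock_eq_add_sub (φ : Fin 7 → ℝ) {B B' : Matrix (Fin 3) (Fin 3) ℝ} (hB : B.IsSymm)
    (hB' : B'.IsSymm) (h : ∀ j, B' 0 j = B 0 j) :
    trivBlock φ B' = trivBlock φ B + (B - B') := by
  have h1 := (hB'.apply 0 1).trans ((h 1).trans (hB.apply 0 1).symm)
  have h2 := (hB'.apply 0 2).trans ((h 2).trans (hB.apply 0 2).symm)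
  ext i j
  fin_cases i <;> fin_cases j <;>
    simp [trivBlock, h, h1, h2, hB.apply 1 2, hB'.apply 1 2] <;> ring

theorem trivBlock_combo (φ : Fin 7 → ℝ) (B B' : Matrix (Fin 3) (Fin 3) ℝ) {a b : ℝ}
    (hab : a + b = 1) :
    trivBlock φ (a • B + b • B') = a • trivBlock φ B + b • trivBlock φ B' := by
  obtain rfl := eq_sub_of_add_eq hab
  ext i j
  fin_cases i <;> fin_cases j <;> simp [trivBlock] <;> ring

theorem continuous_trivBlock (φ : Fin 7 → ℝ) : Continuous (trivBlock φ) := by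
  refine continuous_matrix fun i j => ?_
  fin_cases i <;> fin_cases j <;> unfold trivBlock <;> fun_prop

/-- The standard blocks `B` for which both `B` and the trivial block determined by `φ` and `B` are
positive semidefinite. The sign condition `B 2 2 ≤ φ 5` is not imposed. -/
def blockFibre (φ : Fin 7 → ℝ) : Set (Matrix (Fin 3) (Fin 3) ℝ) :=
  {B | B.PosSemidef ∧ (trivBlock φ B).PosSemidef}

theorem convex_blockFibre (φ : Fin 7 → ℝ) : Convex ℝ (blockFibre φ) := by
  rintro B ⟨hB, hA⟩ B' ⟨hB', hA'⟩ a b ha hb hab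
  refine ⟨(hB.smul ha).add (hB'.smul hb), ?_⟩
  rw [trivBlock_combo φ B B' hab]
  exact (hA.smul ha).add (hA'.smul hb)

theorem vecMulVec_pivotVec_mem_blockFibre {φ : Fin 7 → ℝ} {B : Matrix (Fin 3) (Fin 3) ℝ}
    (hB : B ∈ blockFibre φ) :
    Matrix.vecMulVec (pivotVec B 0) (pivotVec B 0) ∈ blockFibre φ := by
  refine ⟨posSemidef_vecMulVec_self _, ?_⟩
  rw [trivBlock_eq_add_sub φ (isSymm_of_posSemidef hB.1)
    (isSymm_of_posSemidef (posSemidef_vecMulVec_self _)) (vecMulVec_pivotVec_apply hB.1 0)]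
  exact hB.2.add (posSemidef_sub_vecMulVec_pivotVec hB.1 0)

section Cusp

/-- The univariate sextic obtained from the coordinates `φ` by restricting to the cuspidal curve
`q ^ 3 = r ^ 2`, parametrized by `(e, q, r) = (1, t ^ 2, t ^ 3)`, on which the contribution of the
sign block vanishes. -/
noncomputable def cuspPoly (φ : Fin 7 → ℝ) : Polynomial ℝ :=
  .C (φ 0) + .C (φ 1) * .X ^ 2 + .C (φ 2) * .X ^ 3 + .C (φ 3) * .X ^ 4 + .C (φ 4) * .X ^ 5 +
    .C (φ 5 + φ 6) * .X ^ 6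

/-- The values `e ^ 3, e q, r` of the invariants on the cuspidal curve. -/
def trivCusp (t : ℝ) : Fin 3 → ℝ := ![1, t ^ 2, t ^ 3]

/-- The vector against which the standard block is evaluated on the cuspidal curve. -/
def stdCusp (t : ℝ) : Fin 3 → ℝ := ![t, t ^ 2, t ^ 3]

theorem eval_cuspPoly (φ : Fin 7 → ℝ) {B : Matrix (Fin 3) (Fin 3) ℝ} (hB : B.IsSymm) (t : ℝ) :
    (cuspPoly φ).eval t =
      trivCusp t ⬝ᵥ trivBlock φ B *ᵥ trivCusp t + stdCusp t ⬝ᵥ B *ᵥ stdCusp t := by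
  simp [cuspPoly, trivCusp, stdCusp, trivBlock, Matrix.mulVec, dotProduct, Fin.sum_univ_three,
    hB.apply 0 1, hB.apply 0 2, hB.apply 1 2]
  ring

theorem eq_of_forall_trivCusp {A A' : Matrix (Fin 3) (Fin 3) ℝ} (hA : A.IsSymm) (hA' : A'.IsSymm)
    (h : ∀ t, trivCusp t ⬝ᵥ A *ᵥ trivCusp t = trivCusp t ⬝ᵥ A' *ᵥ trivCusp t) : A = A' := by
  have h0 := h 0
  have h1 := h 1
  have h2 := h (-1)
  have h3 := h 2
  have h4 := h (-2)
  have h5 := h 3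
  simp only [trivCusp, Matrix.mulVec, dotProduct, Fin.sum_univ_three, Matrix.cons_val_zero,
    Matrix.cons_val_one, Matrix.cons_val, hA.apply 0 1, hA'.apply 0 1, hA.apply 0 2,
    hA'.apply 0 2, hA.apply 1 2, hA'.apply 1 2] at h0 h1 h2 h3 h4 h5
  ext i j
  fin_cases i <;> fin_cases j <;>
    simp [hA.apply 0 1, hA'.apply 0 1, hA.apply 0 2, hA'.apply 0 2, hA.apply 1 2,
      hA'.apply 1 2] <;>
    linarith

theorem exists_eval_eq_sq_add_sq_cusp {p : Polynomial ℝ} (hp : ∀ t, 0 ≤ p.eval t)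
    (hdeg : p.natDegree ≤ 6) (h1 : p.coeff 1 = 0) :
    ∃ s w : Fin 3 → ℝ, ∀ t, p.eval t = (trivCusp t ⬝ᵥ s) ^ 2 + (stdCusp t ⬝ᵥ w) ^ 2 := by
  obtain ⟨q, r, rfl, hq1, hr0⟩ := exists_eq_sq_add_sq_of_coeff_one_eq_zero hp h1
  obtain ⟨hq, hr⟩ := natDegree_le_of_natDegree_sq_add_sq_le (n := 3) hdeg
  refine ⟨![q.coeff 0, q.coeff 2, q.coeff 3], ![r.coeff 1, r.coeff 2, r.coeff 3], fun t => ?_⟩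
  have heval : ∀ p : Polynomial ℝ, p.natDegree ≤ 3 → p.eval t =
      p.coeff 0 + p.coeff 1 * t + p.coeff 2 * t ^ 2 + p.coeff 3 * t ^ 3 := fun p hp => by
    simp [Polynomial.eval_eq_sum_range' (Nat.lt_succ_of_le hp), Finset.sum_range_succ]
  simp [heval q hq, heval r hr, hq1, hr0, trivCusp, stdCusp, dotProduct, Fin.sum_univ_three]
  ring

theorem dotProduct_vecMulVec_self_mulVec {n : Type*} [Fintype n] (u v : n → ℝ) :
    u ⬝ᵥ Matrix.vecMulVec v v *ᵥ u = (u ⬝ᵥ v) ^ 2 := by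
  rw [Matrix.vecMulVec_mulVec, op_smul_eq_smul, dotProduct_smul, smul_eq_mul, dotProduct_comm v, sq]

theorem exists_trivBlock_vecMulVec_eq_vecMulVec {φ : Fin 7 → ℝ} (hφ : (blockFibre φ).Nonempty) :
    ∃ s w : Fin 3 → ℝ, trivBlock φ (Matrix.vecMulVec w w) = Matrix.vecMulVec s s := by
  obtain ⟨B, hB, hA⟩ := hφ
  have hnonneg : ∀ t, 0 ≤ (cuspPoly φ).eval t := fun t => by
    rw [eval_cuspPoly φ (isSymm_of_posSemidef hB)]
    exact add_nonneg (by simpa using hA.dotProduct_mulVec_nonneg (trivCusp t))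
      (by simpa using hB.dotProduct_mulVec_nonneg (stdCusp t))
  obtain ⟨s, w, hsw⟩ := exists_eval_eq_sq_add_sq_cusp hnonneg
    (by rw [cuspPoly]; compute_degree) (by simp [cuspPoly, Polynomial.coeff_X_pow, -map_add])
  refine ⟨s, w, eq_of_forall_trivCusp (isSymm_trivBlock _ _)
    (isSymm_of_posSemidef (posSemidef_vecMulVec_self s)) fun t => ?_⟩
  have h := hsw t
  rw [eval_cuspPoly φ (isSymm_of_posSemidef (posSemidef_vecMulVec_self w)),
    dotProduct_vecMulVec_self_mulVec] at h
  rw [dotProduct_vecMulVec_self_mulVec]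
  exact add_right_cancel h

end Cusp

theorem exists_not_posSemidef_trivBlock (φ : Fin 7 → ℝ) (w : Fin 3 → ℝ) :
    ∃ x, ¬ (trivBlock φ (Matrix.vecMulVec ![x, w 1, w 2] ![x, w 1, w 2])).PosSemidef := by
  obtain ⟨x, hx, hxw⟩ : ∃ x, |x| = |φ 1| + 4 * |φ 0 * φ 3| + 1 ∧ 0 ≤ x * w 2 := by
    rcases le_total 0 (w 2) with hw | hw
    · exact ⟨_, abs_of_pos (by positivity), by positivity⟩
    · exact ⟨-(|φ 1| + 4 * |φ 0 * φ 3| + 1), by rw [abs_neg, abs_of_pos (by positivity)],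
        mul_nonneg_of_nonpos_of_nonpos (neg_nonpos.mpr (by positivity)) hw⟩
  refine ⟨x, fun hA => ?_⟩
  have h0 := hA.diag_nonneg (i := 0)
  have hminor := sq_apply_le_of_posSemidef hA 0 1
  simp only [trivBlock, Matrix.vecMulVec_apply, Matrix.of_apply, Matrix.cons_val', Matrix.cons_val,
    Matrix.cons_val_zero, Matrix.cons_val_one, Matrix.cons_val_fin_one] at h0 hminor
  have hx1 : 1 ≤ |x| := by
    rw [hx]
    linarith [abs_nonneg (φ 1), abs_nonneg (φ 0 * φ 3)]
  have hgap : 4 * |φ 0 * φ 3| + 1 ≤ x * x - φ 1 := by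
    rw [← abs_mul_abs_self x]
    linarith [le_mul_of_one_le_left (abs_nonneg x) hx1, le_abs_self (φ 1)]
  nlinarith [le_abs_self (φ 0 * φ 3), abs_nonneg (φ 0 * φ 3), mul_nonneg h0 hxw,
    mul_nonneg h0 (mul_self_nonneg (w 1))]

theorem exists_singular_trivBlock {φ : Fin 7 → ℝ} {w : Fin 3 → ℝ}
    (hw : Matrix.vecMulVec w w ∈ blockFibre φ) :
    ∃ v : Fin 3 → ℝ, v 2 = w 2 ∧ Matrix.vecMulVec v v ∈ blockFibre φ ∧
      (trivBlock φ (Matrix.vecMulVec v v)).det = 0 := by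
  obtain ⟨x₁, hx₁⟩ := exists_not_posSemidef_trivBlock φ w
  have hpath : Continuous fun x : ℝ =>
      trivBlock φ (Matrix.vecMulVec ![x, w 1, w 2] ![x, w 1, w 2]) := by
    have hvec : Continuous fun x : ℝ => ![x, w 1, w 2] := by fun_prop
    exact (continuous_trivBlock φ).comp (hvec.matrix_vecMulVec hvec)
  have h₀ : ![w 0, w 1, w 2] = w := by
    ext i
    fin_cases i <;> rfl
  obtain ⟨x, hx, hdet⟩ := exists_posSemidef_det_eq_zero hpath
    (fun x => (Matrix.conjTranspose_eq_transpose_of_trivial _).trans (isSymm_trivBlock φ _))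
    (x₀ := w 0) (by rw [h₀]; exact hw.2) hx₁
  exact ⟨![x, w 1, w 2], rfl, ⟨posSemidef_vecMulVec_self _, hx⟩, hdet⟩

theorem exists_pivot_eq_or_square {φ : Fin 7 → ℝ} {B : Matrix (Fin 3) (Fin 3) ℝ}
    (hB : B ∈ blockFibre φ) (hc : B 2 2 ≤ φ 5) :
    ∃ w : Fin 3 → ℝ, Matrix.vecMulVec w w ∈ blockFibre φ ∧ w 2 ^ 2 ≤ φ 5 ∧
      (w = 0 ∨ w 2 ^ 2 = φ 5 ∨
        ∃ s, trivBlock φ (Matrix.vecMulVec w w) = Matrix.vecMulVec s s) := by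
  obtain ⟨s, w, hs⟩ := exists_trivBlock_vecMulVec_eq_vecMulVec ⟨B, hB⟩
  have hw : Matrix.vecMulVec w w ∈ blockFibre φ :=
    ⟨posSemidef_vecMulVec_self w, hs ▸ posSemidef_vecMulVec_self s⟩
  rcases le_or_gt (w 2 ^ 2) (φ 5) with hle | hlt
  · exact ⟨w, hw, hle, .inr (.inr ⟨s, hs⟩)⟩
  -- The pivot vector `v` of `B'` has `v 2 ^ 2 = B' 0 2 ^ 2 / B' 0 0`, so we look for a zero of
  -- `B' 0 2 ^ 2 - φ 5 * B' 0 0` on the segment from `B` to `w wᵀ`.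
  have hcont : Continuous fun B' : Matrix (Fin 3) (Fin 3) ℝ => B' 0 2 ^ 2 - φ 5 * B' 0 0 := by
    fun_prop
  obtain ⟨B', hB', hzero⟩ := (convex_blockFibre φ).isPreconnected.intermediate_value hB hw
    hcont.continuousOn (show (0 : ℝ) ∈ Set.Icc _ _ from
      ⟨by nlinarith [sq_apply_le_of_posSemidef hB.1 0 2, hB.1.diag_nonneg (i := 0)],
        by simp only [Matrix.vecMulVec_apply]; nlinarith [sq_nonneg (w 0)]⟩)
  have hsq : pivotVec B' 0 2 ^ 2 = B' 0 2 ^ 2 / B' 0 0 := by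
    rw [pivotVec, Pi.smul_apply, smul_eq_mul, mul_pow, inv_pow, Real.sq_sqrt hB'.1.diag_nonneg,
      inv_mul_eq_div]
  rcases eq_or_ne (B' 0 0) 0 with h0 | h0
  · have hv : pivotVec B' 0 = 0 := by rw [pivotVec, h0, Real.sqrt_zero, inv_zero, zero_smul]
    exact ⟨_, vecMulVec_pivotVec_mem_blockFibre hB',
      by simpa [hv] using hB.1.diag_nonneg.trans hc, .inl hv⟩
  · have hv : pivotVec B' 0 2 ^ 2 = φ 5 := by
      rw [hsq, div_eq_iff h0]
      exact sub_eq_zero.mp hzero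
    exact ⟨_, vecMulVec_pivotVec_mem_blockFibre hB', hv.le, .inr (.inl hv)⟩

theorem exists_blockRank_le_four {φ : Fin 7 → ℝ} {B : Matrix (Fin 3) (Fin 3) ℝ}
    (hB : B ∈ blockFibre φ) (hc : B 2 2 ≤ φ 5) :
    ∃ B' ∈ blockFibre φ, B' 2 2 ≤ φ 5 ∧ blockRank (trivBlock φ B') B' (φ 5 - B' 2 2) ≤ 4 := by
  obtain ⟨w, hw, hwc, rfl | hw2 | ⟨s, hs⟩⟩ := exists_pivot_eq_or_square hB hc
  · rw [Matrix.zero_vecMulVec] at hw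
    refine ⟨0, hw, by simpa using hwc, (blockRank_le _ _ _).trans ?_⟩
    have hA := (trivBlock φ 0).rank_le_card_height
    rw [Fintype.card_fin] at hA
    rw [Matrix.rank_zero]
    omega
  · obtain ⟨v, hv2, hv, hdet⟩ := exists_singular_trivBlock hw
    have hvc : Matrix.vecMulVec v v 2 2 = φ 5 := by
      rw [Matrix.vecMulVec_apply, ← sq, hv2, hw2]
    refine ⟨_, hv, hvc.le, ?_⟩
    have hA := det_eq_zero_iff_rank_lt.mp hdet
    have hBrank := Matrix.rank_vecMulVec_le v v
    rw [Fintype.card_fin] at hA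
    rw [blockRank, hvc, sub_self, if_pos rfl]
    omega
  · refine ⟨_, hw, by rwa [Matrix.vecMulVec_apply, ← sq], ?_⟩
    have hA := Matrix.rank_vecMulVec_le s s
    have hBrank := Matrix.rank_vecMulVec_le w w
    refine (blockRank_le _ _ _).trans ?_
    rw [hs]
    omega

section Hypersurface

variable {σ : Type*}

/-- A set of real points is nongeneric if a nonzero polynomial vanishes on it; a property of points
holds generically if it holds outside such a set. -/
def IsNongeneric (S : Set (σ → ℝ)) : Prop :=
  ∃ P : MvPolynomial σ ℝ, P ≠ 0 ∧ ∀ x ∈ S, eval x P = 0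

theorem IsNongeneric.mono {S T : Set (σ → ℝ)} (hT : IsNongeneric T) (h : S ⊆ T) :
    IsNongeneric S :=
  let ⟨P, hP, hPT⟩ := hT
  ⟨P, hP, fun x hx => hPT x (h hx)⟩

theorem IsNongeneric.union {S T : Set (σ → ℝ)} (hS : IsNongeneric S) (hT : IsNongeneric T) :
    IsNongeneric (S ∪ T) := by
  obtain ⟨P, hP, hPS⟩ := hS
  obtain ⟨Q, hQ, hQT⟩ := hT
  refine ⟨P * Q, mul_ne_zero hP hQ, ?_⟩
  rintro x (hx | hx)
  · rw [map_mul, hPS x hx, zero_mul]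
  · rw [map_mul, hQT x hx, mul_zero]

theorem isNongeneric_setOf_apply_eq_zero (i : σ) : IsNongeneric {x : σ → ℝ | x i = 0} :=
  ⟨X i, X_ne_zero i, fun _ hx => (eval_X i).trans hx⟩

theorem IsNongeneric.image_mulVec [Fintype σ] {S : Set (σ → ℝ)}
    (hS : IsNongeneric S) (M : Matrix σ σ ℝ) : IsNongeneric ((M *ᵥ ·) '' S) := by
  classical
  by_cases hM : M.det = 0
  · obtain ⟨v, hv, hvM⟩ := Matrix.exists_vecMul_eq_zero_iff.mpr hM
    have eval_sum (x) : eval x (∑ i, C (v i) * X i) = v ⬝ᵥ x := by simp [dotProduct]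
    refine ⟨∑ i, C (v i) * X i, fun h => hv ?_, ?_⟩
    · rw [← dotProduct_self_eq_zero, ← eval_sum, h, map_zero]
    · rintro _ ⟨x, -, rfl⟩
      rw [eval_sum, Matrix.dotProduct_mulVec, hvM, zero_dotProduct]
  · obtain ⟨P, hP, hPS⟩ := hS
    have hdet : IsUnit M.det := isUnit_iff_ne_zero.mpr hM
    have eval_bind (x : σ → ℝ) : eval (M *ᵥ x) (bind₁ M⁻¹.toMvPolynomial P) = eval x P := by
      rw [← aeval_eq_eval, aeval_bind₁]
      simp [aeval_eq_eval, Matrix.toMvPolynomial_eval_eq_apply, Matrix.nonsing_inv_mul M hdet]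
    refine ⟨bind₁ M⁻¹.toMvPolynomial P, fun h => hP (funext fun x => ?_), ?_⟩
    · rw [← eval_bind, h]
      simp
    · rintro _ ⟨x, hx, rfl⟩
      rw [eval_bind, hPS x hx]

theorem isNongeneric_range_eval {τ : Type*} [Fintype σ] [Fintype τ]
    (h : Fintype.card τ < Fintype.card σ) (ψ : σ → MvPolynomial τ ℝ) :
    IsNongeneric (Set.range fun y i => eval y (ψ i)) := by
  have hdep : ¬ AlgebraicIndependent ℝ ψ := fun hψ => by
    have hle := hψ.lift_cardinalMk_le_trdeg
    rw [trdeg_of_isDomain] at hle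
    simp only [Cardinal.mk_fintype, Cardinal.lift_natCast, Nat.cast_le] at hle
    omega
  rw [algebraicIndependent_iff] at hdep
  push Not at hdep
  obtain ⟨P, hP, hne⟩ := hdep
  refine ⟨P, hne, ?_⟩
  rintro _ ⟨y, rfl⟩
  simpa [aeval_bind₁, aeval_eq_eval] using congrArg (aeval (R := ℝ) y) hP

end Hypersurface

theorem isNongeneric_setOf_det_trivBlock_zero :
    IsNongeneric {φ : Fin 7 → ℝ | (trivBlock φ 0).det = 0} := by
  let P : Matrix (Fin 3) (Fin 3) (MvPolynomial (Fin 7) ℝ) :=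
    !![2 * X 0, X 1, X 2; X 1, 2 * X 3, X 4; X 2, X 4, 2 * (X 5 + X 6)]
  have eval_det (φ : Fin 7 → ℝ) : eval φ P.det = 8 * (trivBlock φ 0).det := by
    simp [P, Matrix.det_fin_three, trivBlock]
    ring
  refine ⟨P.det, fun h => ?_, fun φ hφ => by rw [eval_det, hφ.out, mul_zero]⟩
  have hone := eval_det ![1, 0, 0, 1, 0, 0, 1]
  rw [h, map_zero] at hone
  simp [trivBlock, Matrix.det_fin_three] at hone

theorem isNongeneric_setOf_gramCoord_vecMulVec :
    IsNongeneric {φ | ∃ s w : Fin 3 → ℝ,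
      gramCoord (Matrix.vecMulVec s s) (Matrix.vecMulVec w w) 0 = φ} := by
  let ψ : Fin 7 → MvPolynomial (Fin 3 ⊕ Fin 3) ℝ :=
    let s i := X (.inl i)
    let w i := X (.inr i)
    ![s 0 ^ 2, 2 * (s 0 * s 1) + w 0 ^ 2, 2 * (s 0 * s 2) + 2 * (w 0 * w 1),
      s 1 ^ 2 + 2 * (w 0 * w 2) + w 1 ^ 2, 2 * (s 1 * s 2) + 2 * (w 1 * w 2), w 2 ^ 2, s 2 ^ 2]
  refine (isNongeneric_range_eval (by simp) ψ).mono ?_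
  rintro _ ⟨s, w, rfl⟩
  refine ⟨Sum.elim s w, ?_⟩
  ext i
  fin_cases i <;> simp [ψ, gramCoord, Matrix.vecMulVec_apply, pow_two]

theorem isNongeneric_setOf_gramCoord_blockRank_le_three :
    IsNongeneric {φ | ∃ A B c, A.PosSemidef ∧ B.PosSemidef ∧ blockRank A B c ≤ 3 ∧
      gramCoord A B c = φ} := by
  refine ((((isNongeneric_setOf_apply_eq_zero 5).union isNongeneric_setOf_det_trivBlock_zero).union
    (isNongeneric_setOf_apply_eq_zero 0)).union isNongeneric_setOf_gramCoord_vecMulVec).mono ?_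
  rintro _ ⟨A, B, c, hA, hB, hrank, rfl⟩
  rw [blockRank] at hrank
  have hBrank : B.rank ≤ 1 := by omega
  obtain hB0 | hB1 : B.rank = 0 ∨ B.rank = 1 := by omega
  · obtain rfl := eq_zero_of_rank_matrix_eq_zero hB0
    refine .inl (.inl ?_)
    by_cases hc : c = 0
    · exact .inl (by simp [gramCoord, hc])
    · rw [if_neg hc] at hrank
      refine .inr ?_
      rw [Set.mem_ofPred_eq, trivBlock_gramCoord (isSymm_of_posSemidef hA), det_eq_zero_iff_rank_lt,
        Fintype.card_fin]
      omega
  · by_cases hc : c = 0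
    · obtain ⟨s, rfl⟩ := exists_eq_vecMulVec_of_posSemidef_of_rank_le_one hA (by omega)
      obtain ⟨w, rfl⟩ := exists_eq_vecMulVec_of_posSemidef_of_rank_le_one hB hBrank
      exact .inr ⟨s, w, by rw [hc]⟩
    · rw [if_neg hc] at hrank
      obtain rfl := eq_zero_of_rank_matrix_eq_zero (A := A) (by omega)
      exact .inl (.inr (by simp [gramCoord]))

section CompactSets

variable {ι : Type*} {K : Set (Matrix ι ι ℝ)}

theorem isCompact_of_isClosed_of_posSemidef_of_diag_le [Finite ι] (hK : IsClosed K)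
    (hpos : ∀ Q ∈ K, Q.PosSemidef) {c : ι → ℝ} (hc : ∀ Q ∈ K, ∀ i, Q i i ≤ c i) : IsCompact K := by
  have hbox : IsCompact (Set.univ.pi fun i => Set.univ.pi fun j =>
      Set.Icc (-√(c i * c j)) √(c i * c j) : Set (ι → ι → ℝ)) :=
    isCompact_univ_pi fun i => isCompact_univ_pi fun j => isCompact_Icc
  refine hbox.of_isClosed_subset hK fun Q hQ i _ j _ => ?_
  have hdiag (i) : 0 ≤ Q i i := (hpos Q hQ).diag_nonneg
  rw [Set.mem_Icc, ← abs_le]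
  refine Real.abs_le_sqrt ((sq_apply_le_of_posSemidef (hpos Q hQ) i j).trans ?_)
  exact mul_le_mul (hc Q hQ i) (hc Q hQ j) (hdiag j) ((hdiag i).trans (hc Q hQ i))

variable [Fintype ι]

theorem isExtreme_setOf_ker_le (hpos : ∀ Q ∈ K, Q.PosSemidef) (Q : Matrix ι ι ℝ) :
    IsExtreme ℝ K {R | R ∈ K ∧ ∀ v, Q *ᵥ v = 0 → R *ᵥ v = 0} := by
  refine ⟨fun R hR => hR.1, ?_⟩
  rintro R₁ h₁ R₂ h₂ _ hR ⟨a, b, ha, hb, -, rfl⟩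
  refine ⟨h₁, fun v hv => ((hpos R₁ h₁).dotProduct_mulVec_zero_iff v).mp ?_⟩
  have hsum := congrArg (v ⬝ᵥ ·) (hR.2 v hv)
  simp only [Matrix.add_mulVec, Matrix.smul_mulVec, dotProduct_add, dotProduct_smul,
    dotProduct_zero, smul_eq_mul] at hsum
  have h₁v := (hpos R₁ h₁).dotProduct_mulVec_nonneg v
  have h₂v := (hpos R₂ h₂).dotProduct_mulVec_nonneg v
  simp only [star_trivial] at h₁v h₂v ⊢
  have hzero : a * (v ⬝ᵥ R₁ *ᵥ v) = 0 := by
    linarith [mul_nonneg ha.le h₁v, mul_nonneg hb.le h₂v]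
  exact (mul_eq_zero.mp hzero).resolve_left ha.ne'

theorem rank_le_of_ker_le {Q R : Matrix ι ι ℝ} (h : ∀ v, Q *ᵥ v = 0 → R *ᵥ v = 0) :
    R.rank ≤ Q.rank := by
  have hker : LinearMap.ker Q.mulVecLin ≤ LinearMap.ker R.mulVecLin := fun v hv => h v hv
  have hfinrank := Submodule.finrank_mono hker
  have hQ := Q.mulVecLin.finrank_range_add_finrank_ker
  have hR := R.mulVecLin.finrank_range_add_finrank_ker
  rw [Matrix.rank, Matrix.rank]
  omega

theorem exists_extremePoint_rank_le (hK : IsCompact K) (hpos : ∀ Q ∈ K, Q.PosSemidef)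
    {Q : Matrix ι ι ℝ} (hQ : Q ∈ K) : ∃ R ∈ K.extremePoints ℝ, R.rank ≤ Q.rank := by
  have hclosed : IsClosed {R : Matrix ι ι ℝ | ∀ v, Q *ᵥ v = 0 → R *ᵥ v = 0} := by
    simp only [Set.ofPred_forall]
    exact isClosed_iInter fun v => isClosed_iInter fun _ =>
      isClosed_eq (by fun_prop) continuous_const
  have : LocallyConvexSpace ℝ (Matrix ι ι ℝ) := inferInstanceAs (LocallyConvexSpace ℝ (ι → ι → ℝ))
  obtain ⟨R, hR⟩ := (hK.inter_right hclosed).extremePoints_nonempty ⟨Q, hQ, fun _ => id⟩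
  exact ⟨R, (isExtreme_setOf_ker_le hpos Q).extremePoints_subset_extremePoints hR,
    rank_le_of_ker_le hR.1.2⟩

end CompactSets

section Gram

variable {n d : ℕ}

/-- The vector `m(x)` of the values at `x` of the monomials of degree `d`. -/
noncomputable def monoVec (d : ℕ) (x : Fin n → ℝ) : Sym (Fin n) d → ℝ :=
  fun s => eval x (monoForm s)

/-- The coordinates, in the basis of monomials of degree `d`, of the degree `d` part of `p`. -/
noncomputable def coeffVec (d : ℕ) (p : MvPolynomial (Fin n) ℝ) : Sym (Fin n) d → ℝ :=
  fun s => coeff (Multiset.toFinsupp (s : Multiset (Fin n))) p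

theorem monoVec_apply (x : Fin n → ℝ) (s : Sym (Fin n) d) :
    monoVec d x s = ((s : Multiset (Fin n)).map x).prod := by
  simp [monoVec, monoForm, map_multiset_prod, Multiset.map_map]

theorem monoForm_eq_monomial (s : Sym (Fin n) d) :
    monoForm s = monomial (Multiset.toFinsupp (s : Multiset (Fin n))) (1 : ℝ) := by
  rw [monoForm]
  induction (s : Multiset (Fin n)) using Multiset.induction_on with
  | empty => simp
  | cons a t ih =>
    rw [Multiset.map_cons, Multiset.prod_cons, ih, ← Multiset.singleton_add, map_add,
      Multiset.toFinsupp_singleton, X, monomial_mul, one_mul]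

theorem coeffVec_sum_monoForm (v : Sym (Fin n) d → ℝ) :
    coeffVec d (∑ t, C (v t) * monoForm t) = v := by
  classical
  ext s
  simp only [coeffVec, coeff_sum, coeff_C_mul, monoForm_eq_monomial, coeff_monomial,
    EmbeddingLike.apply_eq_iff_eq, Sym.coe_inj, mul_ite, mul_one, mul_zero, Finset.sum_ite_eq',
    Finset.mem_univ, if_true]

theorem eval_sum_monoForm (v : Sym (Fin n) d → ℝ) (x : Fin n → ℝ) :
    eval x (∑ t, C (v t) * monoForm t) = v ⬝ᵥ monoVec d x := by
  simp [dotProduct, monoVec]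

theorem sum_coeffVec_monoForm {p : MvPolynomial (Fin n) ℝ} (hp : p.IsHomogeneous d) :
    ∑ t, C (coeffVec d p t) * monoForm t = p := by
  have degree_toFinsupp (s : Sym (Fin n) d) :
      (Multiset.toFinsupp (s : Multiset (Fin n))).degree = d := by
    have hcard := Finsupp.card_toMultiset (Multiset.toFinsupp (s : Multiset (Fin n)))
    rw [Multiset.toFinsupp_toMultiset, Sym.card_coe] at hcard
    exact hcard.symm
  ext m
  by_cases hm : m.degree = d
  · obtain ⟨s, rfl⟩ : ∃ s : Sym (Fin n) d, m = Multiset.toFinsupp (s : Multiset (Fin n)) :=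
      ⟨⟨Finsupp.toMultiset m, (Finsupp.card_toMultiset m).trans hm⟩,
        (Finsupp.toMultiset_toFinsupp m).symm⟩
    exact congrFun (coeffVec_sum_monoForm (coeffVec d p)) s
  · rw [hp.coeff_eq_zero hm, coeff_sum]
    refine Finset.sum_eq_zero fun s _ => ?_
    rw [coeff_C_mul, monoForm_eq_monomial, coeff_monomial, if_neg, mul_zero]
    rintro rfl
    exact hm (degree_toFinsupp s)

theorem coeffVec_dotProduct_monoVec {p : MvPolynomial (Fin n) ℝ} (hp : p.IsHomogeneous d)
    (x : Fin n → ℝ) : coeffVec d p ⬝ᵥ monoVec d x = eval x p := by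
  rw [← eval_sum_monoForm, sum_coeffVec_monoForm hp]

theorem eq_zero_of_forall_dotProduct_monoVec {v : Sym (Fin n) d → ℝ}
    (h : ∀ x, v ⬝ᵥ monoVec d x = 0) : v = 0 := by
  have hsum : ∑ t, C (v t) * monoForm t = 0 :=
    MvPolynomial.funext fun x => by rw [eval_sum_monoForm, h, map_zero]
  rw [← coeffVec_sum_monoForm v, hsum]
  ext
  exact coeff_zero _

theorem span_range_monoVec : Submodule.span ℝ (Set.range (monoVec (n := n) d)) = ⊤ := by
  by_contra hne
  obtain ⟨f, hf, hle⟩ := Submodule.exists_le_ker_of_lt_top _ (lt_top_iff_ne_top.mpr hne)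
  obtain ⟨v, rfl⟩ := (dotProductEquiv ℝ (Sym (Fin n) d)).surjective f
  refine hf ?_
  rw [eq_zero_of_forall_dotProduct_monoVec fun x => hle (Submodule.subset_span ⟨x, rfl⟩), map_zero]

theorem eval_gramForm (Q : Matrix (Sym (Fin n) d) (Sym (Fin n) d) ℝ) (x : Fin n → ℝ) :
    eval x (gramForm Q) = monoVec d x ⬝ᵥ (Q *ᵥ monoVec d x) := by
  simp only [gramForm, map_sum, map_mul, eval_C, dotProduct, Matrix.mulVec, Finset.mul_sum, monoVec]
  exact Finset.sum_congr rfl fun s _ => Finset.sum_congr rfl fun t _ => by ring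

theorem gramForm_eq_iff {Q : Matrix (Sym (Fin n) d) (Sym (Fin n) d) ℝ}
    {f : MvPolynomial (Fin n) ℝ} :
    gramForm Q = f ↔ ∀ x, monoVec d x ⬝ᵥ (Q *ᵥ monoVec d x) = eval x f := by
  simp only [← eval_gramForm]
  exact ⟨fun h x => by rw [h], MvPolynomial.funext⟩

theorem matrix_ext_of_monoVec {Q Q' : Matrix (Sym (Fin n) d) (Sym (Fin n) d) ℝ}
    (h : ∀ x y, monoVec d x ⬝ᵥ (Q *ᵥ monoVec d y) = monoVec d x ⬝ᵥ (Q' *ᵥ monoVec d y)) :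
    Q = Q' := by
  have hrow (y) : (Q - Q') *ᵥ monoVec d y = 0 := eq_zero_of_forall_dotProduct_monoVec fun x => by
    rw [dotProduct_comm, Matrix.sub_mulVec, dotProduct_sub, h, sub_self]
  ext s t
  exact sub_eq_zero.mp (congrFun (eq_zero_of_forall_dotProduct_monoVec (v := (Q - Q') s)
    fun y => congrFun (hrow y) s) t)

theorem permRep_mulVec_monoVec (σ : Equiv.Perm (Fin n)) (x : Fin n → ℝ) :
    permRep σ *ᵥ monoVec d x = monoVec d (x ∘ σ.symm) := by
  ext s
  have eq_map_iff (t : Sym (Fin n) d) : s = t.map σ ↔ t = s.map σ.symm := by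
    constructor <;> rintro rfl <;> simp [Sym.map_map]
  simp only [Matrix.mulVec, dotProduct, permRep, Matrix.of_apply, eq_map_iff, ite_mul, one_mul,
    zero_mul, Finset.sum_ite_eq', Finset.mem_univ, if_true, monoVec_apply, Sym.coe_map,
    Multiset.map_map]

theorem dotProduct_conj_permRep_mulVec (Q : Matrix (Sym (Fin n) d) (Sym (Fin n) d) ℝ)
    (σ : Equiv.Perm (Fin n)) (u v : Sym (Fin n) d → ℝ) :
    u ⬝ᵥ (((permRep σ)ᵀ * Q * permRep σ) *ᵥ v) =
      (permRep σ *ᵥ u) ⬝ᵥ (Q *ᵥ (permRep σ *ᵥ v)) := by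
  rw [← Matrix.mulVec_mulVec, ← Matrix.mulVec_mulVec, Matrix.dotProduct_mulVec u,
    Matrix.vecMul_transpose]

theorem forall_conj_permRep_eq_of_forall_monoVec {Q : Matrix (Sym (Fin n) d) (Sym (Fin n) d) ℝ}
    (h : ∀ (σ : Equiv.Perm (Fin n)) (x y),
      monoVec d (x ∘ σ) ⬝ᵥ (Q *ᵥ monoVec d (y ∘ σ)) = monoVec d x ⬝ᵥ (Q *ᵥ monoVec d y))
    (σ : Equiv.Perm (Fin n)) : (permRep σ)ᵀ * Q * permRep σ = Q :=
  matrix_ext_of_monoVec fun x y => by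
    rw [dotProduct_conj_permRep_mulVec, permRep_mulVec_monoVec, permRep_mulVec_monoVec, h]

theorem dotProduct_vecMulVec_mulVec {ι : Type*} [Fintype ι] (u v w z : ι → ℝ) :
    u ⬝ᵥ (Matrix.vecMulVec v w *ᵥ z) = (v ⬝ᵥ u) * (w ⬝ᵥ z) := by
  rw [Matrix.vecMulVec_mulVec, dotProduct_smul, dotProduct_comm u v]
  simp

theorem exists_posSemidef_gramForm_eq {f : MvPolynomial (Fin n) ℝ} (hf : IsSOSForm n d f) :
    ∃ Q : Matrix (Sym (Fin n) d) (Sym (Fin n) d) ℝ, Q.PosSemidef ∧ gramForm Q = f := by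
  obtain ⟨k, q, hq, rfl⟩ := hf
  refine ⟨∑ i, Matrix.vecMulVec (coeffVec d (q i)) (coeffVec d (q i)),
    Matrix.posSemidef_sum _ fun i _ => posSemidef_vecMulVec_self _, gramForm_eq_iff.mpr fun x => ?_⟩
  simp only [Matrix.sum_mulVec, dotProduct_sum, dotProduct_vecMulVec_mulVec,
    coeffVec_dotProduct_monoVec (hq _), map_sum, map_mul, pow_two]

/-- The average of the conjugates of `Q` under the permutations of the variables: the projection of
`Q` onto the invariant matrices. -/
noncomputable def permAverage (Q : Matrix (Sym (Fin n) d) (Sym (Fin n) d) ℝ) :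
    Matrix (Sym (Fin n) d) (Sym (Fin n) d) ℝ :=
  (Fintype.card (Equiv.Perm (Fin n)) : ℝ)⁻¹ •
    ∑ σ : Equiv.Perm (Fin n), (permRep σ)ᵀ * Q * permRep σ

theorem dotProduct_permAverage_mulVec (Q : Matrix (Sym (Fin n) d) (Sym (Fin n) d) ℝ)
    (x y : Fin n → ℝ) :
    monoVec d x ⬝ᵥ (permAverage Q *ᵥ monoVec d y) =
      (Fintype.card (Equiv.Perm (Fin n)) : ℝ)⁻¹ * ∑ σ : Equiv.Perm (Fin n),
        monoVec d (x ∘ σ.symm) ⬝ᵥ (Q *ᵥ monoVec d (y ∘ σ.symm)) := by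
  simp only [permAverage, Matrix.smul_mulVec, dotProduct_smul, smul_eq_mul, Matrix.sum_mulVec,
    dotProduct_sum, dotProduct_conj_permRep_mulVec, permRep_mulVec_monoVec]

theorem permAverage_mem_symPSDCone {Q : Matrix (Sym (Fin n) d) (Sym (Fin n) d) ℝ}
    (hQ : Q.PosSemidef) : permAverage Q ∈ symPSDCone n d := by
  refine ⟨.smul (Matrix.posSemidef_sum _ fun σ _ => ?_) (by positivity),
    forall_conj_permRep_eq_of_forall_monoVec fun τ x y => ?_⟩
  · simpa using hQ.conjTranspose_mul_mul_same (permRep σ)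
  · rw [dotProduct_permAverage_mulVec, dotProduct_permAverage_mulVec]
    congr 1
    exact Fintype.sum_equiv (Equiv.mulRight τ⁻¹) _ _ fun σ => rfl

theorem gramForm_permAverage {Q : Matrix (Sym (Fin n) d) (Sym (Fin n) d) ℝ}
    (hQ : (gramForm Q).IsSymmetric) : gramForm (permAverage Q) = gramForm Q := by
  refine gramForm_eq_iff.mpr fun x => ?_
  have eval_comp (σ : Equiv.Perm (Fin n)) :
      monoVec d (x ∘ σ.symm) ⬝ᵥ (Q *ᵥ monoVec d (x ∘ σ.symm)) = eval x (gramForm Q) := by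
    rw [← eval_gramForm, ← eval_rename, hQ σ.symm]
  rw [dotProduct_permAverage_mulVec]
  simp only [eval_comp, Finset.sum_const, Finset.card_univ, nsmul_eq_mul]
  exact inv_mul_cancel_left₀ (Nat.cast_ne_zero.mpr Fintype.card_ne_zero) _

theorem symGramSpectrahedron_nonempty {f : MvPolynomial (Fin n) ℝ} (hf : f.IsSymmetric)
    (hsos : IsSOSForm n d f) : (symGramSpectrahedron n d f).Nonempty := by
  obtain ⟨Q, hQ, rfl⟩ := exists_posSemidef_gramForm_eq hsos
  exact ⟨permAverage Q, permAverage_mem_symPSDCone hQ, gramForm_permAverage hf⟩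

theorem exists_dotProduct_mulVec_le_of_mem_symGramSpectrahedron (f : MvPolynomial (Fin n) ℝ)
    (v : Sym (Fin n) d → ℝ) : ∃ C, ∀ Q ∈ symGramSpectrahedron n d f, v ⬝ᵥ (Q *ᵥ v) ≤ C := by
  induction span_range_monoVec.ge (Submodule.mem_top (x := v)) using Submodule.span_induction with
  | mem v hv =>
    obtain ⟨x, rfl⟩ := hv
    exact ⟨eval x f, fun Q hQ => (gramForm_eq_iff.mp hQ.2 x).le⟩
  | zero => exact ⟨0, by simp⟩
  | add u v _ _ hu hv =>
    obtain ⟨C₁, hC₁⟩ := hu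
    obtain ⟨C₂, hC₂⟩ := hv
    refine ⟨2 * C₁ + 2 * C₂, fun Q hQ => ?_⟩
    have hsub := hQ.1.1.dotProduct_mulVec_nonneg (u - v)
    simp only [star_trivial, Matrix.mulVec_sub, Matrix.mulVec_add, dotProduct_sub, sub_dotProduct,
      dotProduct_add, add_dotProduct] at hsub ⊢
    linarith [hC₁ Q hQ, hC₂ Q hQ]
  | smul a v _ hv =>
    obtain ⟨C, hC⟩ := hv
    refine ⟨a * (a * C), fun Q hQ => ?_⟩
    simp only [Matrix.mulVec_smul, dotProduct_smul, smul_dotProduct, smul_eq_mul]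
    linarith [mul_le_mul_of_nonneg_left (hC Q hQ) (mul_self_nonneg a)]

theorem isClosed_symGramSpectrahedron (f : MvPolynomial (Fin n) ℝ) :
    IsClosed (symGramSpectrahedron n d f) := by
  simp only [symGramSpectrahedron, symPSDCone, gramForm_eq_iff, Set.ofPred_and, Set.ofPred_forall]
  exact (isClosed_setOf_posSemidef.inter (isClosed_iInter fun σ =>
    isClosed_eq (by fun_prop) (by fun_prop))).inter
    (isClosed_iInter fun x => isClosed_eq (by fun_prop) (by fun_prop))

theorem isCompact_symGramSpectrahedron (f : MvPolynomial (Fin n) ℝ) :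
    IsCompact (symGramSpectrahedron n d f) := by
  choose C hC using exists_dotProduct_mulVec_le_of_mem_symGramSpectrahedron (d := d) f
  refine isCompact_of_isClosed_of_posSemidef_of_diag_le (isClosed_symGramSpectrahedron f)
    (c := fun s => C (Pi.single s 1)) (fun Q hQ => hQ.1.1) fun Q hQ s => ?_
  simpa using hC (Pi.single s 1) Q hQ

end Gram

section CoeffMatrix

variable {n d : ℕ} {ι : Type*}

/-- The matrix whose columns are the coordinates, in the basis of monomials of degree `d`, of a
family of forms. -/
noncomputable def coeffMatrix (d : ℕ) (p : ι → MvPolynomial (Fin n) ℝ) :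
    Matrix (Sym (Fin n) d) ι ℝ :=
  Matrix.of fun s i => coeffVec d (p i) s

theorem coeffMatrix_transpose_mulVec_monoVec {p : ι → MvPolynomial (Fin n) ℝ}
    (hp : ∀ i, (p i).IsHomogeneous d) (x : Fin n → ℝ) :
    (coeffMatrix d p)ᵀ *ᵥ monoVec d x = fun i => eval x (p i) :=
  funext fun i => coeffVec_dotProduct_monoVec (hp i) x

theorem dotProduct_conj_coeffMatrix_mulVec [Fintype ι] {p : ι → MvPolynomial (Fin n) ℝ}
    (hp : ∀ i, (p i).IsHomogeneous d) (A : Matrix ι ι ℝ) (x y : Fin n → ℝ) :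
    monoVec d x ⬝ᵥ ((coeffMatrix d p * A * (coeffMatrix d p)ᵀ) *ᵥ monoVec d y) =
      (fun i => eval x (p i)) ⬝ᵥ (A *ᵥ fun i => eval y (p i)) := by
  rw [← Matrix.mulVec_mulVec, ← Matrix.mulVec_mulVec, Matrix.dotProduct_mulVec,
    ← Matrix.mulVec_transpose, coeffMatrix_transpose_mulVec_monoVec hp,
    coeffMatrix_transpose_mulVec_monoVec hp]

end CoeffMatrix

theorem eval_symSextic_gramCoord {A B : Matrix (Fin 3) (Fin 3) ℝ} (hA : A.IsSymm) (hB : B.IsSymm)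
    (c : ℝ) (x : Fin 3 → ℝ) : eval x (symSextic (gramCoord A B c)) =
      (fun i => eval x (invForm i)) ⬝ᵥ (A *ᵥ fun i => eval x (invForm i))
      + 1 / 6 * ∑ k, (fun i => eval x (stdForm i k)) ⬝ᵥ (B *ᵥ fun i => eval x (stdForm i k))
      + c / 108 * (eval x devAlt * eval x devAlt) := by
  have hy : eval x (devVar 2) = -(eval x (devVar 0) + eval x (devVar 1)) := by
    rw [devVar_two, map_neg, map_add]
  simp only [symSextic, gramCoord, sexticBasis, invForm, stdForm, devAlt_eq, devQuad, devCub,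
    dotProduct, Matrix.mulVec, Fin.sum_univ_three, Fin.sum_univ_seven, Fin.prod_univ_three,
    Matrix.cons_val, map_add, map_sub, map_mul, map_pow, eval_C, hy, hA.apply 0 1, hA.apply 0 2,
    hA.apply 1 2, hB.apply 0 1, hB.apply 0 2, hB.apply 1 2]
  ring

/-- The symmetric Gram matrix with blocks `A`, `B` and `c`. The factors `1 / 6` and `1 / 108` make
`gramCoord` integral. -/
noncomputable def blockGram (A B : Matrix (Fin 3) (Fin 3) ℝ) (c : ℝ) :
    Matrix (Sym (Fin 3) 3) (Sym (Fin 3) 3) ℝ :=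
  coeffMatrix 3 invForm * A * (coeffMatrix 3 invForm)ᵀ
    + (1 / 6 : ℝ) • ∑ k, coeffMatrix 3 (stdForm · k) * B * (coeffMatrix 3 (stdForm · k))ᵀ
    + (c / 108) • Matrix.vecMulVec (coeffVec 3 devAlt) (coeffVec 3 devAlt)

section BlockGram

variable {A B : Matrix (Fin 3) (Fin 3) ℝ} {c : ℝ}

theorem dotProduct_blockGram_mulVec (A B : Matrix (Fin 3) (Fin 3) ℝ) (c : ℝ) (x y : Fin 3 → ℝ) :
    monoVec 3 x ⬝ᵥ (blockGram A B c *ᵥ monoVec 3 y) =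
      (fun i => eval x (invForm i)) ⬝ᵥ (A *ᵥ fun i => eval y (invForm i))
      + 1 / 6 * ∑ k, (fun i => eval x (stdForm i k)) ⬝ᵥ (B *ᵥ fun i => eval y (stdForm i k))
      + c / 108 * (eval x devAlt * eval y devAlt) := by
  simp only [blockGram, Matrix.add_mulVec, Matrix.smul_mulVec, Matrix.sum_mulVec, dotProduct_add,
    dotProduct_smul, dotProduct_sum, smul_eq_mul, dotProduct_vecMulVec_mulVec,
    dotProduct_conj_coeffMatrix_mulVec isHomogeneous_invForm,
    dotProduct_conj_coeffMatrix_mulVec (isHomogeneous_stdForm · _),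
    coeffVec_dotProduct_monoVec isHomogeneous_devAlt]

theorem gramForm_blockGram (hA : A.IsSymm) (hB : B.IsSymm) (c : ℝ) :
    gramForm (blockGram A B c) = symSextic (gramCoord A B c) :=
  gramForm_eq_iff.mpr fun x => by
    rw [dotProduct_blockGram_mulVec, eval_symSextic_gramCoord hA hB]

theorem posSemidef_blockGram (hA : A.PosSemidef) (hB : B.PosSemidef) (hc : 0 ≤ c) :
    (blockGram A B c).PosSemidef := by
  have hconj {M : Matrix (Fin 3) (Fin 3) ℝ} (hM : M.PosSemidef)
      (S : Matrix (Sym (Fin 3) 3) (Fin 3) ℝ) : (S * M * Sᵀ).PosSemidef := by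
    simpa using hM.mul_mul_conjTranspose_same S
  exact ((hconj hA _).add ((Matrix.posSemidef_sum _ fun k _ => hconj hB _).smul (by norm_num))).add
    ((posSemidef_vecMulVec_self _).smul (by positivity))

theorem blockGram_mem_symPSDCone (hA : A.PosSemidef) (hB : B.PosSemidef) (hc : 0 ≤ c) :
    blockGram A B c ∈ symPSDCone 3 3 := by
  refine ⟨posSemidef_blockGram hA hB hc, forall_conj_permRep_eq_of_forall_monoVec fun σ x y => ?_⟩
  have hsign : ((Equiv.Perm.sign σ : ℤ) : ℝ) * (Equiv.Perm.sign σ : ℤ) = 1 := by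
    rw [← Int.cast_mul, Int.units_coe_mul_self, Int.cast_one]
  have hstd := Equiv.sum_comp σ fun k =>
    (fun i => eval x (stdForm i k)) ⬝ᵥ (B *ᵥ fun i => eval y (stdForm i k))
  simp only [dotProduct_blockGram_mulVec, ← eval_rename, rename_invForm, rename_stdForm,
    rename_devAlt, hstd, map_mul, map_intCast, mul_mul_mul_comm, hsign, one_mul]

theorem rank_blockGram_le (A B : Matrix (Fin 3) (Fin 3) ℝ) (c : ℝ) :
    (blockGram A B c).rank ≤ blockRank A B c := by
  have hstd : ∑ k, coeffMatrix 3 (stdForm · k) = 0 := by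
    ext s i
    have hsum := congrArg (coeff (Multiset.toFinsupp (s : Multiset (Fin 3)))) (sum_stdForm i)
    rwa [coeff_sum, coeff_zero] at hsum
  refine (rank_matrix_add_le _ _).trans (add_le_add ((rank_matrix_add_le _ _).trans (add_le_add
    ((Matrix.rank_mul_le_left _ _).trans (Matrix.rank_mul_le_right _ _)) ?_)) ?_)
  · have hsixth : (1 / 6 : ℝ) ∈ nonZeroDivisors ℝ := mem_nonZeroDivisors_of_ne_zero (by norm_num)
    rw [Matrix.rank_smul_of_mem_nonZeroDivisors _ hsixth]
    exact rank_sum_conj_le hstd B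
  · split_ifs with hc
    · simp [hc]
    · rw [← Matrix.smul_vecMulVec]
      exact Matrix.rank_vecMulVec_le _ _

end BlockGram

section InvariantBilinForm

variable {K ι V : Type*} [CommRing K] [AddCommGroup V] [Module K V]
  {β : LinearMap.BilinForm K V}

theorem bilinForm_eq_zero_of_neg [IsAddTorsionFree K] {f : V → V}
    (hβ : ∀ u v, β (f u) (f v) = β u v) {u v : V} (hu : f u = u) (hv : f v = -v) : β u v = 0 := by
  have h := hβ u v
  rw [hu, hv, map_neg] at h
  exact neg_eq_self.mp h

variable {ρ : Equiv.Perm ι → V → V} (hβ : ∀ σ u v, β (ρ σ u) (ρ σ v) = β u v)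

include hβ

theorem bilinForm_fixed_permuted_eq_zero [IsDomain K] [CharZero K] [Fintype ι] {u : V}
    (hu : ∀ σ, ρ σ u = u) {z : ι → V} (hz : ∀ σ k, ρ σ (z k) = z (σ k))
    (hsum : ∑ k, z k = 0) (k : ι) : β u (z k) = 0 := by
  classical
  have hconst (l) : β u (z l) = β u (z k) := by
    rw [← hβ (Equiv.swap k l) u (z k), hu, hz, Equiv.swap_apply_left]
  have h := congrArg (β u) hsum
  simp only [map_sum, hconst, Finset.sum_const, Finset.card_univ, nsmul_eq_mul, map_zero] at h
  have : Nonempty ι := ⟨k⟩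
  exact (mul_eq_zero.mp h).resolve_left (Nat.cast_ne_zero.mpr Fintype.card_ne_zero)

theorem bilinForm_permuted_self {z z' : ι → V} (hz : ∀ σ k, ρ σ (z k) = z (σ k))
    (hz' : ∀ σ k, ρ σ (z' k) = z' (σ k)) (k l : ι) : β (z k) (z' k) = β (z l) (z' l) := by
  classical
  rw [← hβ (Equiv.swap k l) (z k), hz, hz', Equiv.swap_apply_left]

theorem bilinForm_permuted_of_ne [Fintype ι] {z z' : ι → V}
    (hz : ∀ σ k, ρ σ (z k) = z (σ k)) (hz' : ∀ σ k, ρ σ (z' k) = z' (σ k))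
    (hsum : ∑ k, z' k = 0) {k l : ι} (hkl : k ≠ l) :
    ((Fintype.card ι : K) - 1) * β (z k) (z' l) = -β (z k) (z' k) := by
  classical
  have hconst {m} (hm : m ∈ Finset.univ.erase k) : β (z k) (z' m) = β (z k) (z' l) := by
    rw [← hβ (Equiv.swap l m) (z k) (z' l), hz, hz', Equiv.swap_apply_left,
      Equiv.swap_apply_of_ne_of_ne hkl (Finset.ne_of_mem_erase hm).symm]
  have h := congrArg (β (z k)) hsum
  rw [map_sum, map_zero, ← Finset.add_sum_erase _ _ (Finset.mem_univ k),
    Finset.sum_congr rfl fun m => hconst, Finset.sum_const,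
    Finset.card_erase_of_mem (Finset.mem_univ k), Finset.card_univ, nsmul_eq_mul,
    Nat.cast_sub (Fintype.card_pos_iff.mpr ⟨k⟩), Nat.cast_one] at h
  exact eq_neg_of_add_eq_zero_right h

end InvariantBilinForm

section FormGram

variable {m ι : Type*} [Fintype m]

/-- The Gram matrix of the family `u` of vectors with respect to the bilinear form with matrix
`Q`. -/
def formGram (Q : Matrix m m ℝ) (u : ι → m → ℝ) : Matrix ι ι ℝ :=
  Matrix.of u * Q * (Matrix.of u)ᵀ

theorem formGram_apply [DecidableEq m] (Q : Matrix m m ℝ) (u : ι → m → ℝ) (i j : ι) :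
    formGram Q u i j = Q.toBilin' (u i) (u j) := by
  rw [formGram, Matrix.mul_assoc, Matrix.toBilin'_apply']
  rfl

theorem posSemidef_formGram {Q : Matrix m m ℝ} (hQ : Q.PosSemidef) [Finite ι] (u : ι → m → ℝ) :
    (formGram Q u).PosSemidef := by
  simpa [formGram] using hQ.mul_mul_conjTranspose_same (Matrix.of u)

theorem rank_formGram_le [Fintype ι] (Q : Matrix m m ℝ) (u : ι → m → ℝ) :
    (formGram Q u).rank ≤ Q.rank :=
  (Matrix.rank_mul_le_left _ _).trans (Matrix.rank_mul_le_right _ _)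

end FormGram

noncomputable section

/-- The points `p_k = 3 ε_k - (1, 1, 1)`, in which a point `x` with `e = e(x)` and `y_k = y_k(x)`
reads `3 x = e (1, 1, 1) + (y₀ p₀ + y₁ p₁ + y₂ p₂) / 3`. -/
def devPoint (k : Fin 3) : Fin 3 → ℝ := 3 • Pi.single k 1 - 1

/-- The parts of `m(1 + p_k) / 27`, with `p_k` the point `devPoint k`, which are linear, quadratic
and cubic in `p_k`. -/
def orbitVec (i k : Fin 3) : Sym (Fin 3) 3 → ℝ :=
  ![(1 / 54 : ℝ) • (monoVec 3 (1 + devPoint k) - monoVec 3 (1 - devPoint k)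
      - (2 : ℝ) • monoVec 3 (devPoint k)),
    (1 / 54 : ℝ) • (monoVec 3 (1 + devPoint k) + monoVec 3 (1 - devPoint k)
      - (2 : ℝ) • monoVec 3 1),
    (1 / 27 : ℝ) • monoVec 3 (devPoint k)] i

/-- Vectors dual to the invariant cubic forms `invForm` (see `monoVec_eq_sum`). -/
def invVec : Fin 3 → Sym (Fin 3) 3 → ℝ :=
  ![(1 / 27 : ℝ) • monoVec 3 1, (1 / 3 : ℝ) • ∑ k, orbitVec 1 k, (1 / 3 : ℝ) • ∑ k, orbitVec 2 k]

/-- Vectors dual to the three copies `stdForm` of the standard representation (see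
`monoVec_eq_sum`). -/
def stdVec (i k : Fin 3) : Sym (Fin 3) 3 → ℝ := orbitVec i k - (1 / 3 : ℝ) • ∑ l, orbitVec i l

/-- The vector dual to the alternating cubic form `devAlt` (see `monoVec_eq_sum`). -/
def altVec : Sym (Fin 3) 3 → ℝ :=
  (1 / 324 : ℝ) • ∑ σ : Equiv.Perm (Fin 3), (Equiv.Perm.sign σ : ℤ) • monoVec 3 (![-1, 0, 1] ∘ σ)

end

theorem sum_stdVec (i : Fin 3) : ∑ k, stdVec i k = 0 := by
  simp only [stdVec, Fin.sum_univ_three]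
  module

theorem exists_monoVec_apply_eq (s : Sym (Fin 3) 3) :
    ∃ a b c : Fin 3, ∀ p : Fin 3 → ℝ, monoVec 3 p s = p a * p b * p c := by
  obtain ⟨a, b, c, h⟩ := Multiset.card_eq_three.mp s.card_coe
  refine ⟨a, b, c, fun p => ?_⟩
  rw [monoVec_apply, h]
  simp [mul_assoc]

section Action

variable (σ : Equiv.Perm (Fin 3))

theorem devPoint_comp_symm (k : Fin 3) : devPoint k ∘ σ.symm = devPoint (σ k) := by
  ext i
  simp [devPoint, Pi.single_apply, Equiv.symm_apply_eq]

theorem permRep_mulVec_orbitVec (i k : Fin 3) : permRep σ *ᵥ orbitVec i k = orbitVec i (σ k) := by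
  have hone : (1 : Fin 3 → ℝ) ∘ σ.symm = 1 := rfl
  have hadd : (1 + devPoint k) ∘ σ.symm = 1 + devPoint (σ k) := by
    rw [← devPoint_comp_symm]
    rfl
  have hsub : (1 - devPoint k) ∘ σ.symm = 1 - devPoint (σ k) := by
    rw [← devPoint_comp_symm]
    rfl
  fin_cases i <;>
    simp [orbitVec, Matrix.mulVec_smul, Matrix.mulVec_sub, Matrix.mulVec_add,
      permRep_mulVec_monoVec, hone, hadd, hsub, devPoint_comp_symm]

theorem permRep_mulVec_sum_orbitVec (i : Fin 3) :
    permRep σ *ᵥ ∑ k, orbitVec i k = ∑ k, orbitVec i k := by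
  rw [Matrix.mulVec_sum]
  simp only [permRep_mulVec_orbitVec]
  exact Equiv.sum_comp σ (orbitVec i)

theorem permRep_mulVec_invVec (i : Fin 3) : permRep σ *ᵥ invVec i = invVec i := by
  fin_cases i
  · have hone : (1 : Fin 3 → ℝ) ∘ σ.symm = 1 := rfl
    simp [invVec, Matrix.mulVec_smul, permRep_mulVec_monoVec, hone]
  all_goals exact (Matrix.mulVec_smul _ _ _).trans (congrArg _ (permRep_mulVec_sum_orbitVec σ _))

theorem permRep_mulVec_stdVec (i k : Fin 3) : permRep σ *ᵥ stdVec i k = stdVec i (σ k) := by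
  rw [stdVec, Matrix.mulVec_sub, Matrix.mulVec_smul, permRep_mulVec_orbitVec,
    permRep_mulVec_sum_orbitVec, stdVec]

theorem permRep_mulVec_altVec : permRep σ *ᵥ altVec = (Equiv.Perm.sign σ : ℤ) • altVec := by
  rw [altVec, Matrix.mulVec_smul, Matrix.mulVec_sum, smul_comm (_ : ℤ),
    Finset.smul_sum (r := (_ : ℤ))]
  refine congrArg ((1 / 324 : ℝ) • ·) (Fintype.sum_equiv (Equiv.mulRight σ⁻¹) _ _ fun τ => ?_)
  rw [Matrix.mulVec_smul, permRep_mulVec_monoVec, smul_smul, Equiv.coe_mulRight,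
    Equiv.Perm.sign_mul, Equiv.Perm.sign_inv, mul_comm (Equiv.Perm.sign τ), ← Units.val_mul,
    ← mul_assoc, Int.units_mul_self, one_mul]
  rfl

end Action

theorem orbitVec_apply {s : Sym (Fin 3) 3} {a b c : Fin 3}
    (hs : ∀ p : Fin 3 → ℝ, monoVec 3 p s = p a * p b * p c) (i k : Fin 3) :
    orbitVec i k s = 1 / 27 * ![devPoint k a + devPoint k b + devPoint k c,
      devPoint k a * devPoint k b + devPoint k a * devPoint k c + devPoint k b * devPoint k c,
      devPoint k a * devPoint k b * devPoint k c] i := by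
  fin_cases i <;> simp [orbitVec, hs] <;> ring

theorem altVec_eq : altVec = (1 / 324 : ℝ) •
    (monoVec 3 ![-1, 0, 1] + monoVec 3 ![0, 1, -1] + monoVec 3 ![1, -1, 0]
      - monoVec 3 ![1, 0, -1] - monoVec 3 ![0, -1, 1] - monoVec 3 ![-1, 1, 0]) := by
  have hcomp (σ : Equiv.Perm (Fin 3)) : ![(-1 : ℝ), 0, 1] ∘ σ =
      ![![-1, 0, 1] (σ 0), ![-1, 0, 1] (σ 1), ![-1, 0, 1] (σ 2)] := by
    ext i
    fin_cases i <;> rfl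
  have huniv : (Finset.univ : Finset (Equiv.Perm (Fin 3))) =
      {1, finRotate 3, finRotate 3 * finRotate 3, Equiv.swap 0 2, Equiv.swap 1 0,
        Equiv.swap 1 2} := by
    decide
  have hrot0 : finRotate 3 0 = 1 := rfl
  have hrot1 : finRotate 3 1 = 2 := rfl
  have hrot2 : finRotate 3 2 = 0 := rfl
  rw [altVec, huniv, Finset.sum_insert (by decide), Finset.sum_insert (by decide),
    Finset.sum_insert (by decide), Finset.sum_insert (by decide), Finset.sum_insert (by decide),
    Finset.sum_singleton]
  simp only [hcomp, hrot0, hrot1, hrot2, Matrix.cons_val, Equiv.Perm.mul_apply,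
    Equiv.Perm.one_apply, Equiv.swap_apply_def, Fin.reduceEq, if_true, if_false,
    Equiv.Perm.sign_one, Equiv.Perm.sign_mul, Equiv.Perm.sign_swap', sign_finRotate, Units.val_one,
    Units.val_neg, Units.val_mul, Units.val_pow_eq_pow_val]
  module

theorem monoVec_eq_sum (x : Fin 3 → ℝ) : monoVec 3 x = ∑ i, eval x (invForm i) • invVec i
    + (1 / 3 : ℝ) • ∑ i, ∑ k, eval x (stdForm i k) • stdVec i k + eval x devAlt • altVec := by
  ext s
  obtain ⟨a, b, c, hs⟩ := exists_monoVec_apply_eq s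
  have hx (l) : x l = (eval x sumVar + eval x (devVar l)) / 3 := by
    simp [devVar, sumVar]
  have hd (l m) : devPoint l m = if m = l then 2 else -1 := by
    by_cases h : m = l <;> simp [devPoint, h]
    norm_num
  have hy : eval x (devVar 2) = -(eval x (devVar 0) + eval x (devVar 1)) := by
    rw [devVar_two, map_neg, map_add]
  simp only [Pi.add_apply, Pi.smul_apply, Pi.sub_apply, smul_eq_mul, Fin.sum_univ_three,
    Fin.prod_univ_three, invVec, stdVec, orbitVec_apply hs, altVec_eq, invForm, stdForm, devQuad,
    devCub, devAlt_eq, map_mul, map_add, Matrix.cons_val, map_sub, map_pow, eval_C, hs, hx a, hx b,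
    hx c, hd]
  generalize eval x sumVar = e
  fin_cases a <;> fin_cases b <;> fin_cases c <;>
    simp [hy] <;> ring

section Converse

theorem permRep_swap_mulVec_altVec {i j : Fin 3} (hij : i ≠ j) :
    permRep (Equiv.swap i j) *ᵥ altVec = -altVec := by
  simp [permRep_mulVec_altVec, Equiv.Perm.sign_swap hij]

variable {Q : Matrix (Sym (Fin 3) 3) (Sym (Fin 3) 3) ℝ}

theorem toBilin'_permRep_mulVec {n d : ℕ} {Q : Matrix (Sym (Fin n) d) (Sym (Fin n) d) ℝ}
    (hQ : Q ∈ symPSDCone n d) (σ : Equiv.Perm (Fin n)) (u v : Sym (Fin n) d → ℝ) :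
    Q.toBilin' (permRep σ *ᵥ u) (permRep σ *ᵥ v) = Q.toBilin' u v := by
  rw [Matrix.toBilin'_apply', Matrix.toBilin'_apply', ← dotProduct_conj_permRep_mulVec, hQ.2]

theorem toBilin'_comm_of_mem_symPSDCone {n d : ℕ} {Q : Matrix (Sym (Fin n) d) (Sym (Fin n) d) ℝ}
    (hQ : Q ∈ symPSDCone n d) (u v : Sym (Fin n) d → ℝ) :
    Q.toBilin' u v = Q.toBilin' v u := by
  rw [Matrix.toBilin'_apply', Matrix.toBilin'_apply',
    dotProduct_mulVec_comm_of_isSymm (isSymm_of_posSemidef hQ.1)]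

variable (hQ : Q ∈ symPSDCone 3 3)
include hQ

theorem toBilin'_invVec_stdVec (i j k : Fin 3) : Q.toBilin' (invVec i) (stdVec j k) = 0 :=
  bilinForm_fixed_permuted_eq_zero (toBilin'_permRep_mulVec hQ)
    (permRep_mulVec_invVec · i) (permRep_mulVec_stdVec · j) (sum_stdVec j) k

theorem toBilin'_invVec_altVec (i : Fin 3) : Q.toBilin' (invVec i) altVec = 0 :=
  bilinForm_eq_zero_of_neg (toBilin'_permRep_mulVec hQ (Equiv.swap 0 1))
    (permRep_mulVec_invVec _ i) (permRep_swap_mulVec_altVec (by decide))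

theorem toBilin'_stdVec_altVec (j k : Fin 3) : Q.toBilin' (stdVec j k) altVec = 0 := by
  obtain ⟨a, b, hab, hk⟩ : ∃ a b : Fin 3, a ≠ b ∧ Equiv.swap a b k = k := by
    decide +revert
  exact bilinForm_eq_zero_of_neg (toBilin'_permRep_mulVec hQ (Equiv.swap a b))
    (by rw [permRep_mulVec_stdVec, hk]) (permRep_swap_mulVec_altVec hab)

theorem toBilin'_stdVec_stdVec (i j k l : Fin 3) : Q.toBilin' (stdVec i k) (stdVec j l) =
    (if k = l then 1 else -(1 / 2)) * formGram Q (stdVec · 0) i j := by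
  rw [formGram_apply]
  have hself := bilinForm_permuted_self (toBilin'_permRep_mulVec hQ)
    (permRep_mulVec_stdVec · i) (permRep_mulVec_stdVec · j) k 0
  split_ifs with hkl
  · rw [← hkl, hself, one_mul]
  · have hne := bilinForm_permuted_of_ne (toBilin'_permRep_mulVec hQ)
      (permRep_mulVec_stdVec · i) (permRep_mulVec_stdVec · j) (sum_stdVec j) hkl
    rw [hself, Fintype.card_fin] at hne
    push_cast at hne
    linarith

theorem gramForm_eq_symSextic_gramCoord : gramForm Q = symSextic (gramCoord (formGram Q invVec)
    (formGram Q (stdVec · 0)) (108 * Q.toBilin' altVec altVec)) := by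
  have hz (x i) : eval x (stdForm i 2) = -(eval x (stdForm i 0) + eval x (stdForm i 1)) := by
    have h := congrArg (eval x) (sum_stdForm i)
    rw [map_sum, Fin.sum_univ_three, map_zero] at h
    linarith
  refine gramForm_eq_iff.mpr fun x => ?_
  rw [eval_symSextic_gramCoord (isSymm_of_posSemidef (posSemidef_formGram hQ.1 _))
    (isSymm_of_posSemidef (posSemidef_formGram hQ.1 _)), ← Matrix.toBilin'_apply', monoVec_eq_sum]
  have hcomm := toBilin'_comm_of_mem_symPSDCone hQ
  simp only [map_add, map_smul, LinearMap.add_apply, LinearMap.smul_apply,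
    smul_eq_mul, toBilin'_invVec_stdVec hQ, toBilin'_invVec_altVec hQ,
    toBilin'_stdVec_altVec hQ, toBilin'_stdVec_stdVec hQ, hcomm (stdVec _ _) (invVec _),
    hcomm altVec (invVec _), hcomm altVec (stdVec _ _), dotProduct, Matrix.mulVec,
    ← formGram_apply Q invVec, Fin.sum_univ_three, hz]
  simp only [Fin.isValue, Fin.reduceEq, if_true, if_false]
  ring

theorem blockRank_formGram_le_rank : blockRank (formGram Q invVec) (formGram Q (stdVec · 0))
    (108 * Q.toBilin' altVec altVec) ≤ Q.rank := by
  set A := formGram Q invVec with hA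
  set B := formGram Q (stdVec · 0) with hB
  set C : Matrix Unit Unit ℝ := Matrix.of fun _ _ => Q.toBilin' altVec altVec with hC
  let w : (Fin 3 ⊕ Fin 3) ⊕ (Fin 3 ⊕ Unit) → Sym (Fin 3) 3 → ℝ :=
    Sum.elim (Sum.elim invVec (stdVec · 0)) (Sum.elim (fun i => stdVec i 1 - stdVec i 2)
      fun _ => altVec)
  have hblocks : formGram Q w = Matrix.fromBlocks (Matrix.fromBlocks A 0 0 B) 0 0
      (Matrix.fromBlocks ((3 : ℝ) • B) 0 0 C) := by
    have hcomm := toBilin'_comm_of_mem_symPSDCone hQ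
    have hdiff (b : ℝ) : b + 2⁻¹ * b - (-(2⁻¹ * b) - b) = 3 * b := by ring
    ext i j
    rw [formGram_apply]
    rcases i with (i | i) | (i | i) <;> rcases j with (j | j) | (j | j) <;>
      simp [w, hC, ← formGram_apply Q invVec, ← hA, toBilin'_invVec_stdVec hQ,
        toBilin'_invVec_altVec hQ, toBilin'_stdVec_altVec hQ, toBilin'_stdVec_stdVec hQ, hdiff,
        hcomm (stdVec _ _) (invVec _), hcomm altVec (invVec _), hcomm altVec (stdVec _ _), ← hB]
  have hthree : (3 : ℝ) ∈ nonZeroDivisors ℝ := mem_nonZeroDivisors_of_ne_zero (by norm_num)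
  have hrank := rank_formGram_le Q w
  have hAB := rank_add_rank_le_rank_fromBlocks A B
  have hBC := rank_add_rank_le_rank_fromBlocks ((3 : ℝ) • B) C
  rw [Matrix.rank_smul_of_mem_nonZeroDivisors _ hthree] at hBC
  have hABC := rank_add_rank_le_rank_fromBlocks (Matrix.fromBlocks A 0 0 B)
    (Matrix.fromBlocks ((3 : ℝ) • B) 0 0 C)
  have hC1 : (if 108 * Q.toBilin' altVec altVec = 0 then 0 else 1) ≤ C.rank := by
    split_ifs with h
    · exact Nat.zero_le _
    · refine Nat.one_le_iff_ne_zero.mpr fun hC0 => h ?_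
      exact mul_eq_zero_of_right _ (congrFun₂ (eq_zero_of_rank_matrix_eq_zero hC0) () ())
  rw [blockRank]
  rw [hblocks] at hrank
  omega

theorem exists_blocks_of_mem_symPSDCone : ∃ A B c, A.PosSemidef ∧ B.PosSemidef ∧ 0 ≤ c ∧
    gramForm Q = symSextic (gramCoord A B c) ∧ blockRank A B c ≤ Q.rank := by
  have hc : 0 ≤ Q.toBilin' altVec altVec := by
    simpa [Matrix.toBilin'_apply'] using hQ.1.dotProduct_mulVec_nonneg altVec
  exact ⟨_, _, _, posSemidef_formGram hQ.1 _, posSemidef_formGram hQ.1 _, by positivity,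
    gramForm_eq_symSextic_gramCoord hQ, blockRank_formGram_le_rank hQ⟩

end Converse

theorem isNongeneric_setOf_sexticCoeffs_rank_le_three :
    IsNongeneric {a | ∃ Q ∈ symPSDCone 3 3, Q.rank ≤ 3 ∧ sexticCoeffs (gramForm Q) = a} := by
  refine (isNongeneric_setOf_gramCoord_blockRank_le_three.image_mulVec
    (Matrix.of fun i j => sexticCoeffs (sexticBasis j) i)).mono ?_
  rintro _ ⟨Q, hQ, hrank, rfl⟩
  obtain ⟨A, B, c, hA, hB, -, hform, hle⟩ := exists_blocks_of_mem_symPSDCone hQ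
  exact ⟨_, ⟨A, B, c, hA, hB, hle.trans hrank, rfl⟩, by rw [hform, sexticCoeffs_symSextic]⟩

theorem exists_mem_symGramSpectrahedron_rank_le_four {f : MvPolynomial (Fin 3) ℝ}
    (hf : f.IsSymmetric) (hsos : IsSOSForm 3 3 f) :
    ∃ Q ∈ symGramSpectrahedron 3 3 f, Q.rank ≤ 4 := by
  obtain ⟨Q, hQ, rfl⟩ := symGramSpectrahedron_nonempty hf hsos
  obtain ⟨A, B, c, hA, hB, hc, hform, -⟩ := exists_blocks_of_mem_symPSDCone hQ
  set φ := gramCoord A B c with hφ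
  have hφ5 : φ 5 = B 2 2 + c := rfl
  have hfibre : B ∈ blockFibre φ :=
    ⟨hB, by rwa [hφ, trivBlock_gramCoord (isSymm_of_posSemidef hA)]⟩
  obtain ⟨B', ⟨hB', hA'⟩, hc', hrank⟩ := exists_blockRank_le_four hfibre (by linarith)
  refine ⟨blockGram (trivBlock φ B') B' (φ 5 - B' 2 2),
    ⟨blockGram_mem_symPSDCone hA' hB' (sub_nonneg.mpr hc'), ?_⟩,
    (rank_blockGram_le _ _ _).trans hrank⟩
  rw [gramForm_blockGram (isSymm_of_posSemidef hA') (isSymm_of_posSemidef hB'),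
    gramCoord_trivBlock, hform]

/-- For a generic symmetric ternary sextic `f` (its seven coefficients avoid the zero set of some
fixed nonzero polynomial): if `f` is SOS, then every matrix in its symmetry adapted Gram
spectrahedron has rank at least `4`, and some extreme point of it has rank `4`. -/
theorem mainTheorem7 :
    ∃ P : MvPolynomial (Fin 7) ℝ, P ≠ 0 ∧
      ∀ f : MvPolynomial (Fin 3) ℝ, f.IsSymmetric → f.IsHomogeneous 6 →
        MvPolynomial.eval (sexticCoeffs f) P ≠ 0 → IsSOSForm 3 3 f →
          (∀ Q ∈ symGramSpectrahedron 3 3 f, 4 ≤ Q.rank) ∧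
          ∃ Q ∈ (symGramSpectrahedron 3 3 f).extremePoints ℝ, Q.rank = 4 := by
  obtain ⟨P, hP, hzero⟩ := isNongeneric_setOf_sexticCoeffs_rank_le_three
  refine ⟨P, hP, fun f hf _ hPf hsos => ?_⟩
  have hlower : ∀ Q ∈ symGramSpectrahedron 3 3 f, 4 ≤ Q.rank := fun Q hQ => by
    by_contra! hlt
    exact hPf (hzero _ ⟨Q, hQ.1, Nat.le_of_lt_succ hlt, by rw [hQ.2]⟩)
  obtain ⟨Q, hQ, hrank⟩ := exists_mem_symGramSpectrahedron_rank_le_four hf hsos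
  obtain ⟨R, hR, hRQ⟩ := exists_extremePoint_rank_le (isCompact_symGramSpectrahedron f)
    (fun Q hQ => hQ.1.1) hQ
  exact ⟨hlower, R, hR, (hRQ.trans hrank).antisymm (hlower R hR.1)⟩
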